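/- Let $F$ be a finite group, let $n\ge 0$ be an integer, and let $G=\mathbb F_2\times\cdots\times\mathbb F_2\times F$ with $n$ factors equal to the free group $\mathbb F_2$ of rank $2$. Choose any resolution $C$ of the trivial $\mathbb ZF$-module $\mathbb Z$ by finitely generated free $\mathbb ZF$-modules with bases, and let $C^{(n)}$ be the product resolution for $G$, that is, the iterated tensor product over $\mathbb Z$ of $C$ with $n$ copies of the cellular resolution $0\to(\mathbb Z\mathbb F_2)^2\to\mathbb Z\mathbb F_2\to 0$ of the presentation complex of $\mathbb F_2$. Let $k_i$ be the rank of $C^{(n)}_i$, identify $\mathrm{Hom}_{\mathbb ZG}(C^{(n)}_i,\ell^2(G))$ with $\ell^2(G)^{k_i}$, where $G$ acts on $\ell^2(G)$ by the left regular representation, let $d_i$ be the resulting coboundary operators, let $\Delta_n=d_n^*d_n+d_{n-1}d_{n-1}^*$ (with $\Delta_0=d_0^*d_0$) be the $n$-th Laplacian, and let the $n$-th higher Kazhdan projection $p_n$ be the orthogonal projection of $\ell^2(G)^{k_n}$ onto $\ker\Delta_n$. Then: 1. $\Delta_n$ has a spectral gap at $0$: there is $\delta>0$ such that every $z\neq 0$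 in the spectrum of $\Delta_n$ satisfies $|z|\ge\delta$. 2. $p_n$ belongs to $M_{k_n}(\mathrm C^*_{\mathrm{red}}(G))$, and $$[p_n]=\Bigl[\tfrac1{|F|}\sum_{g\in F}g\Bigr]\quad\text{in } \mathrm K_0(\mathrm C^*_{\mathrm{red}}(G)).$$ 3. If $F$ is non-trivial, then $[p_n]$ is not an integer multiple of $[1]$ in $\mathrm K_0(\mathrm C^*_{\mathrm{red}}(G))$. -/

import Mathlib

open scoped Matrix

noncomputable section

namespace HigherKazhdan

/-! ### Operator K-theory: the group `K₀(A)` of a unital C*-algebra `A` -/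

section KTheory

variable {A : Type*} [Ring A] [StarRing A]

/-- Murray-von Neumann equivalence of two projections in (possibly different) matrix algebras over
`A`: `p = v* v` and `q = v v*` for some rectangular matrix `v` over `A`. -/
def MvN {ι κ : Type*} [Fintype ι] [Fintype κ] (p : Matrix ι ι A) (q : Matrix κ κ A) : Prop :=
  ∃ v : Matrix κ ι A, vᴴ * v = p ∧ v * vᴴ = q

section lemmas

variable {ι κ μ ν : Type*} [Fintype ι] [Fintype κ] [Fintype μ] [Fintype ν]

theorem isStarProjection_iff {p : Matrix ι ι A} : IsStarProjection p ↔ p * p = p ∧ pᴴ = p := by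
  constructor
  · intro h
    exact ⟨h.isIdempotentElem, h.isSelfAdjoint⟩
  · intro h
    exact ⟨h.1, h.2⟩

theorem MvN.refl {p : Matrix ι ι A} (hp : IsStarProjection p) : MvN p p := by
  rw [isStarProjection_iff] at hp
  exact ⟨p, by rw [hp.2, hp.1], by rw [hp.2, hp.1]⟩

theorem MvN.symm {p : Matrix ι ι A} {q : Matrix κ κ A} (h : MvN p q) : MvN q p := by
  obtain ⟨v, h1, h2⟩ := h
  exact ⟨vᴴ, by simpa using h2, by simpa using h1⟩

theorem MvN.trans {p : Matrix ι ι A} {q : Matrix κ κ A} {r : Matrix μ μ A}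
    (hp : IsStarProjection p) (hr : IsStarProjection r) (h : MvN p q) (h' : MvN q r) :
    MvN p r := by
  rw [isStarProjection_iff] at hp hr
  obtain ⟨v, h1, h2⟩ := h
  obtain ⟨w, h3, h4⟩ := h'
  refine ⟨w * v, ?_, ?_⟩
  · calc (w * v)ᴴ * (w * v) = vᴴ * (wᴴ * w) * v := by
          simp only [Matrix.conjTranspose_mul, Matrix.mul_assoc]
      _ = (vᴴ * v) * (vᴴ * v) := by rw [h3, ← h2]; simp only [Matrix.mul_assoc]
      _ = p := by rw [h1, hp.1]
  · calc (w * v) * (w * v)ᴴ = w * (v * vᴴ) * wᴴ := by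
          simp only [Matrix.conjTranspose_mul, Matrix.mul_assoc]
      _ = (w * wᴴ) * (w * wᴴ) := by rw [h2, ← h3]; simp only [Matrix.mul_assoc]
      _ = r := by rw [h4, hr.1]

theorem isStarProjection_reindex {p : Matrix ι ι A} (hp : IsStarProjection p) (e : κ ≃ ι) :
    IsStarProjection (p.submatrix e e) := by
  rw [isStarProjection_iff] at hp ⊢
  rw [Matrix.submatrix_mul_equiv, Matrix.conjTranspose_submatrix, hp.1, hp.2]
  exact ⟨rfl, rfl⟩

theorem MvN.reindex {p : Matrix ι ι A} (hp : IsStarProjection p) (e : κ ≃ ι) :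
    MvN p (p.submatrix e e) := by
  rw [isStarProjection_iff] at hp
  refine ⟨p.submatrix e id, ?_, ?_⟩
  · rw [Matrix.conjTranspose_submatrix, Matrix.submatrix_mul_equiv, hp.2, hp.1]
    rfl
  · rw [Matrix.conjTranspose_submatrix, hp.2]
    have := Matrix.submatrix_mul_equiv p p e (Equiv.refl ι) e
    rw [hp.1] at this
    exact this

/-- The block diagonal sum `p ⊕ q`. -/
def dsum (p : Matrix ι ι A) (q : Matrix κ κ A) : Matrix (ι ⊕ κ) (ι ⊕ κ) A :=
  Matrix.fromBlocks p 0 0 q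

theorem isStarProjection_dsum {p : Matrix ι ι A} {q : Matrix κ κ A} (hp : IsStarProjection p)
    (hq : IsStarProjection q) : IsStarProjection (dsum p q) := by
  rw [isStarProjection_iff] at hp hq ⊢
  constructor
  · simp [dsum, Matrix.fromBlocks_multiply, hp.1, hq.1]
  · simp [dsum, Matrix.fromBlocks_conjTranspose, hp.2, hq.2]

theorem MvN.dsum {p : Matrix ι ι A} {p' : Matrix κ κ A} {q : Matrix μ μ A} {q' : Matrix ν ν A}
    (h : MvN p p') (h' : MvN q q') : MvN (dsum p q) (dsum p' q') := by
  obtain ⟨v, h1, h2⟩ := h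
  obtain ⟨w, h3, h4⟩ := h'
  refine ⟨Matrix.fromBlocks v 0 0 w, ?_, ?_⟩
  · simp [HigherKazhdan.dsum, Matrix.fromBlocks_multiply, Matrix.fromBlocks_conjTranspose, h1, h3]
  · simp [HigherKazhdan.dsum, Matrix.fromBlocks_multiply, Matrix.fromBlocks_conjTranspose, h2, h4]

end lemmas

variable (A) in
/-- Projections in the matrix algebras `Mₙ(A)`, `n = 0, 1, 2, …`. -/
def MatProj : Type _ := Σ n : ℕ, {p : Matrix (Fin n) (Fin n) A // IsStarProjection p}

instance matProjSetoid : Setoid (MatProj A) where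
  r p q := MvN p.2.1 q.2.1
  iseqv :=
    { refl := fun p => MvN.refl p.2.2
      symm := fun h => h.symm
      trans := fun {p _ r} h h' => MvN.trans p.2.2 r.2.2 h h' }

variable (A) in
/-- The set `V(A)` of Murray-von Neumann classes of projections in matrix algebras over `A`. -/
def V : Type _ := Quotient (matProjSetoid (A := A))

/-- A projection in the matrix algebra over `A` indexed by a finite type, as an element of
`MatProj A` (by an enumeration of the index type). -/
def MatProj.ofMatrix {ι : Type*} [Fintype ι] (p : Matrix ι ι A) (hp : IsStarProjection p) :
    MatProj A :=
  ⟨Fintype.card ι, p.submatrix (Fintype.equivFin ι).symm (Fintype.equivFin ι).symm,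
    isStarProjection_reindex hp _⟩

/-- The Murray-von Neumann class of a projection in a matrix algebra over `A`. -/
def V.mk {ι : Type*} [Fintype ι] (p : Matrix ι ι A) (hp : IsStarProjection p) : V A :=
  Quotient.mk _ (MatProj.ofMatrix p hp)

theorem V.mk_eq_mk {ι κ : Type*} [Fintype ι] [Fintype κ] {p : Matrix ι ι A} {q : Matrix κ κ A}
    (hp : IsStarProjection p) (hq : IsStarProjection q) : V.mk p hp = V.mk q hq ↔ MvN p q := by
  have h1 := MvN.reindex hp (Fintype.equivFin ι).symm
  have h2 := MvN.reindex hq (Fintype.equivFin κ).symm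
  have h3 := isStarProjection_reindex hp (Fintype.equivFin ι).symm
  have h4 := isStarProjection_reindex hq (Fintype.equivFin κ).symm
  constructor
  · intro h
    have h5 : MvN (MatProj.ofMatrix p hp).2.1 (MatProj.ofMatrix q hq).2.1 := Quotient.exact h
    exact MvN.trans hp hq h1 (MvN.trans h3 hq h5 h2.symm)
  · intro h
    exact Quotient.sound (MvN.trans h3 h4 h1.symm (MvN.trans hp h4 h h2))

theorem V.exists_mk (x : V A) : ∃ (n : ℕ) (p : Matrix (Fin n) (Fin n) A)
    (hp : IsStarProjection p), x = V.mk p hp := by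
  obtain ⟨⟨n, p, hp⟩, rfl⟩ := Quotient.exists_rep x
  exact ⟨n, p, hp, Quotient.sound (MvN.reindex hp _)⟩

instance : Zero (V A) := ⟨V.mk (0 : Matrix (Fin 0) (Fin 0) A) (.zero _)⟩

/-- Addition in `V(A)` is induced by the block diagonal sum of projections. -/
instance : Add (V A) :=
  ⟨Quotient.lift₂ (fun p q => V.mk (dsum p.2.1 q.2.1) (isStarProjection_dsum p.2.2 q.2.2))
    fun _ _ _ _ h h' => (V.mk_eq_mk _ _).2 (MvN.dsum h h')⟩

theorem V.mk_add_mk {ι κ : Type*} [Fintype ι] [Fintype κ] {p : Matrix ι ι A} {q : Matrix κ κ A}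
    (hp : IsStarProjection p) (hq : IsStarProjection q) :
    V.mk p hp + V.mk q hq = V.mk (dsum p q) (isStarProjection_dsum hp hq) :=
  (V.mk_eq_mk _ _).2 (MvN.dsum (MvN.reindex hp _).symm (MvN.reindex hq _).symm)

theorem V.mk_eq_reindex {ι κ : Type*} [Fintype ι] [Fintype κ] {p : Matrix ι ι A}
    {q : Matrix κ κ A} (hp : IsStarProjection p) (hq : IsStarProjection q) (e : κ ≃ ι)
    (h : p.submatrix e e = q) : V.mk p hp = V.mk q hq := by
  subst h
  exact (V.mk_eq_mk _ _).2 (MvN.reindex hp e)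

instance : AddCommMonoid (V A) where
  add_assoc x y z := by
    obtain ⟨l, p, hp, rfl⟩ := V.exists_mk x
    obtain ⟨m, q, hq, rfl⟩ := V.exists_mk y
    obtain ⟨n, r, hr, rfl⟩ := V.exists_mk z
    simp only [V.mk_add_mk]
    refine V.mk_eq_reindex _ _ (Equiv.sumAssoc _ _ _).symm ?_
    ext (i | i | i) (j | j | j) <;> rfl
  zero_add x := by
    obtain ⟨n, p, hp, rfl⟩ := V.exists_mk x
    refine (V.mk_add_mk _ _).trans (V.mk_eq_reindex _ _ (Equiv.emptySum _ _).symm ?_)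
    ext i j
    rfl
  add_zero x := by
    obtain ⟨n, p, hp, rfl⟩ := V.exists_mk x
    refine (V.mk_add_mk _ _).trans (V.mk_eq_reindex _ _ (Equiv.sumEmpty _ _).symm ?_)
    ext i j
    rfl
  add_comm x y := by
    obtain ⟨m, p, hp, rfl⟩ := V.exists_mk x
    obtain ⟨n, q, hq, rfl⟩ := V.exists_mk y
    simp only [V.mk_add_mk]
    refine V.mk_eq_reindex _ _ (Equiv.sumComm _ _) ?_
    ext (i | i) (j | j) <;> rfl
  nsmul := nsmulRec

variable (A) in
/-- The group `K₀(A)`: the Grothendieck group of the monoid `V(A)`. -/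
abbrev K0 : Type _ := Algebra.GrothendieckAddGroup (V A)

/-- The class `[p] ∈ K₀(A)` of a projection `p` in a matrix algebra over `A`. -/
def K0.cls {ι : Type*} [Fintype ι] (p : Matrix ι ι A) (hp : IsStarProjection p) : K0 A :=
  Algebra.GrothendieckAddGroup.of (V.mk p hp)

/-- A projection of `A`, as a projection in the algebra of `1 × 1` matrices over `A`. -/
theorem isStarProjection_one_by_one {a : A} (ha : IsStarProjection a) :
    IsStarProjection (Matrix.of fun _ _ : Unit => a) := by
  rw [isStarProjection_iff]
  refine ⟨?_, ?_⟩
  · ext i j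
    simpa [Matrix.mul_apply] using ha.isIdempotentElem.eq
  · ext i j
    simpa using ha.isSelfAdjoint.star_eq

/-- The class in `K₀(A)` of a projection of `A` itself. -/
def K0.cls₁ (a : A) (ha : IsStarProjection a) : K0 A :=
  K0.cls (Matrix.of fun _ _ : Unit => a) (isStarProjection_one_by_one ha)

end KTheory

/-! ### The reduced group C*-algebra -/

section Reduced

variable (G : Type*) [Group G]

/-- The Hilbert space `ℓ²(G)`. -/
abbrev L2 : Type _ := lp (fun _ : G => ℂ) 2

variable {G}

theorem memℓp_translate (g : G) (f : L2 G) : Memℓp (fun h : G => f (g⁻¹ * h)) 2 := by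
  have h2 : 0 < (2 : ENNReal).toReal := by norm_num
  rw [memℓp_gen_iff h2]
  exact ((memℓp_gen_iff h2).1 (lp.memℓp f)).comp_injective (mul_right_injective g⁻¹)

/-- Left translation by `g` on `ℓ²(G)`: `(λ(g) f)(h) = f(g⁻¹ h)`. -/
def translate (g : G) : L2 G →ₗᵢ[ℂ] L2 G where
  toFun f := ⟨fun h => f (g⁻¹ * h), memℓp_translate g f⟩
  map_add' _ _ := rfl
  map_smul' _ _ := rfl
  norm_map' f := by
    have h2 : 0 < (2 : ENNReal).toReal := by norm_num
    rw [lp.norm_eq_tsum_rpow h2, lp.norm_eq_tsum_rpow h2]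
    congr 1
    exact (Equiv.mulLeft g⁻¹).tsum_eq (fun h => ‖f h‖ ^ (2 : ENNReal).toReal)

theorem translate_apply (g : G) (f : L2 G) (h : G) : translate g f h = f (g⁻¹ * h) := rfl

variable (G) in
/-- The left regular representation `λ` of `G` on `ℓ²(G)`. -/
def leftRegular : G →* (L2 G →L[ℂ] L2 G) where
  toFun g := (translate g).toContinuousLinearMap
  map_one' := by
    ext f h
    simp [translate_apply]
  map_mul' g g' := by
    ext f h
    simp [translate_apply, mul_assoc]

theorem star_leftRegular (g : G) : star (leftRegular G g) = leftRegular G g⁻¹ := by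
  rw [ContinuousLinearMap.star_eq_adjoint, eq_comm, ContinuousLinearMap.eq_adjoint_iff]
  intro x y
  have hx : leftRegular G g (leftRegular G g⁻¹ x) = x := by
    change (leftRegular G g * leftRegular G g⁻¹) x = x
    rw [← map_mul, mul_inv_cancel, map_one]
    rfl
  conv_rhs => rw [← hx]
  exact ((translate g).inner_map_map (leftRegular G g⁻¹ x) y).symm

variable (G) in
/-- The reduced group C*-algebra of `G`: the norm closure in `B(ℓ²(G))` of the `*`-algebra
generated by the operators `λ(g)`, `g ∈ G`. -/
abbrev CStarRed : StarSubalgebra ℂ (L2 G →L[ℂ] L2 G) :=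
  (StarAlgebra.adjoin ℂ (Set.range (leftRegular G))).topologicalClosure

theorem leftRegular_mem (g : G) : leftRegular G g ∈ CStarRed G :=
  StarSubalgebra.le_topologicalClosure _ (StarAlgebra.subset_adjoin ℂ _ ⟨g, rfl⟩)

variable (G) in
/-- The canonical homomorphism `G → C*_red(G)`, `g ↦ λ(g)`. -/
def unitaryOf : G →* CStarRed G where
  toFun g := ⟨leftRegular G g, leftRegular_mem g⟩
  map_one' := Subtype.ext (map_one _)
  map_mul' _ _ := Subtype.ext (map_mul _ _ _)

theorem star_unitaryOf (g : G) : star (unitaryOf G g) = unitaryOf G g⁻¹ :=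
  Subtype.ext (star_leftRegular g)

variable (G) in
/-- The canonical homomorphism `ℤG → C*_red(G)`. -/
def ofGroupRing : MonoidAlgebra ℤ G →+* CStarRed G :=
  (MonoidAlgebra.lift ℤ (CStarRed G) G (unitaryOf G)).toRingHom

/-- For a homomorphism `j` from a finite group `F` to `G`, the averaging element
`(1/|F|) ∑_{g ∈ F} j(g)` in `C*_red(G)`. -/
def average {F : Type*} [Group F] [Fintype F] (j : F →* G) : CStarRed G :=
  (Fintype.card F : ℂ)⁻¹ • ∑ g : F, unitaryOf G (j g)

theorem isStarProjection_average {F : Type*} [Group F] [Fintype F] (j : F →* G) :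
    IsStarProjection (average j) := by
  have hc : (Fintype.card F : ℂ) ≠ 0 := Nat.cast_ne_zero.2 Fintype.card_ne_zero
  constructor
  · have key : (∑ g : F, unitaryOf G (j g)) * (∑ g : F, unitaryOf G (j g))
        = (Fintype.card F : ℂ) • ∑ g : F, unitaryOf G (j g) := by
      rw [Finset.sum_mul]
      have : ∀ g : F, unitaryOf G (j g) * ∑ h : F, unitaryOf G (j h)
          = ∑ h : F, unitaryOf G (j h) := by
        intro g
        rw [Finset.mul_sum, ← Equiv.sum_comp (Equiv.mulLeft g) (fun h => unitaryOf G (j h))]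
        simp
      simp only [this, Finset.sum_const, Finset.card_univ]
      rw [Nat.cast_smul_eq_nsmul]
    unfold IsIdempotentElem average
    rw [smul_mul_smul_comm, key, smul_smul, mul_assoc, inv_mul_cancel₀ hc, mul_one]
  · unfold IsSelfAdjoint average
    rw [star_smul, star_sum]
    congr 1
    · simp
    · simp only [star_unitaryOf, ← map_inv]
      exact Equiv.sum_comp (Equiv.inv F) (fun h => unitaryOf G (j h))

/-- The bounded operator `ℓ²(G)^κ → ℓ²(G)^ι` given by an `ι × κ` matrix over `C*_red(G)`. -/
def matOp {ι κ : Type*} [Fintype ι] [Fintype κ] (M : Matrix ι κ (CStarRed G)) :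
    PiLp 2 (fun _ : κ => L2 G) →L[ℂ] PiLp 2 (fun _ : ι => L2 G) :=
  (PiLp.continuousLinearEquiv 2 ℂ (fun _ : ι => L2 G)).symm.toContinuousLinearMap ∘L
    ContinuousLinearMap.pi fun i =>
      ∑ j, (M i j : L2 G →L[ℂ] L2 G) ∘L PiLp.proj 2 (fun _ : κ => L2 G) j

theorem matOp_apply {ι κ : Type*} [Fintype ι] [Fintype κ] (M : Matrix ι κ (CStarRed G))
    (x : PiLp 2 (fun _ : κ => L2 G)) (i : ι) :
    matOp M x i = ∑ j, (M i j : L2 G →L[ℂ] L2 G) (x j) := by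
  simp [matOp]

end Reduced

/-! ### Based free chain complexes over `ℤG` -/

/-- A nonnegatively graded chain complex of free left `ℤG`-modules of finite rank with chosen
bases, such as the cellular chain complex of the universal cover of a CW model of `BG` with
finitely many cells in each dimension. The basis elements are the `cell`s; the boundary map is
`∂ e_x = ∑_y bd x y • e_y`. -/
structure BasedComplex (G : Type*) [Group G] where
  /-- the basis elements of all degrees -/
  cell : Type
  /-- the degree of a basis element -/
  deg : cell → ℕ
  finite_deg : ∀ i, Finite {c // deg c = i}
  /-- the matrix of the boundary map -/
  bd : cell → cell → MonoidAlgebra ℤ G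
  bd_eq_zero : ∀ x y, deg x ≠ deg y + 1 → bd x y = 0
  bd_bd : ∀ x z, ∑ᶠ y, bd x y * bd y z = 0

namespace BasedComplex

variable {G : Type*} [Group G]

/-- The basis elements of degree `i`. -/
abbrev Cells (C : BasedComplex G) (i : ℕ) : Type := {c : C.cell // C.deg c = i}

instance (C : BasedComplex G) (i : ℕ) : Finite (C.Cells i) := C.finite_deg i

instance (C : BasedComplex G) (i : ℕ) : Fintype (C.Cells i) := Fintype.ofFinite _

/-- The matrix of the boundary map `C_{i+1} → C_i`; on coordinate rows this map is `x ↦ x ᵥ* D`. -/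
def D (C : BasedComplex G) (i : ℕ) : Matrix (C.Cells (i + 1)) (C.Cells i) (MonoidAlgebra ℤ G) :=
  Matrix.of fun x y => C.bd x y

/-- The augmentation `ℤG → ℤ`. -/
def aug : MonoidAlgebra ℤ G →+* ℤ := (MonoidAlgebra.lift ℤ ℤ G 1).toRingHom

/-- `C` is a free resolution of the trivial `ℤG`-module `ℤ`: for some augmentation
`C₀ → ℤ`, `e_c ↦ ε c`, the sequence `⋯ → C₂ → C₁ → C₀ → ℤ → 0` is exact. -/
def IsResolution (C : BasedComplex G) : Prop :=
  ∃ ε : C.Cells 0 → ℤ,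
    (∃ x : C.Cells 0 → MonoidAlgebra ℤ G, ∑ c, aug (x c) * ε c = 1) ∧
    (∀ x : C.Cells 0 → MonoidAlgebra ℤ G, ∑ c, aug (x c) * ε c = 0 ↔ ∃ y, y ᵥ* C.D 0 = x) ∧
    ∀ i, ∀ x : C.Cells (i + 1) → MonoidAlgebra ℤ G,
      x ᵥ* C.D i = 0 ↔ ∃ y, y ᵥ* C.D (i + 1) = x

/-- The space `Hom_{ℤG}(C_i, ℓ²(G)) ≅ ℓ²(G)^{k_i}` of `i`-cochains with coefficients in the left
regular representation, as a Hilbert space. A cochain is given by its values on the basis. -/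
abbrev Cochain (C : BasedComplex G) (i : ℕ) : Type _ := PiLp 2 (fun _ : C.Cells i => L2 G)

/-- The coboundary `d_i`, as a matrix over `C*_red(G)`:
`(d_i f)(e_x) = f(∂ e_x) = ∑_y λ(bd x y) f(e_y)`. -/
def d (C : BasedComplex G) (i : ℕ) : Matrix (C.Cells (i + 1)) (C.Cells i) (CStarRed G) :=
  (C.D i).map (ofGroupRing G)

/-- The combinatorial Laplacian `Δ_i = d_i* d_i + d_{i-1} d_{i-1}*` (and `Δ_0 = d_0* d_0`) of
the left regular representation, as a matrix over `C*_red(G)`. -/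
def laplacian (C : BasedComplex G) : (i : ℕ) → Matrix (C.Cells i) (C.Cells i) (CStarRed G)
  | 0 => (C.d 0)ᴴ * C.d 0
  | i + 1 => (C.d (i + 1))ᴴ * C.d (i + 1) + C.d i * (C.d i)ᴴ

/-- The Laplacian as a bounded operator on the Hilbert space of `i`-cochains. -/
def laplacianOp (C : BasedComplex G) (i : ℕ) : C.Cochain i →L[ℂ] C.Cochain i :=
  matOp (C.laplacian i)

/-- The higher Kazhdan projection `p_i`: the orthogonal projection of the space of `i`-cochains
onto the space `ker Δ_i` of harmonic `i`-cochains. -/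
def kazhdanProjection (C : BasedComplex G) (i : ℕ) : C.Cochain i →L[ℂ] C.Cochain i :=
  (LinearMap.ker (C.laplacianOp i : C.Cochain i →ₗ[ℂ] C.Cochain i)).starProjection

theorem finsum_bd_mul {R : Type*} [Semiring R] (C : BasedComplex G)
    (f : MonoidAlgebra ℤ G →+* R) (x : C.cell) (b : C.cell → MonoidAlgebra ℤ G)
    (T : Finset C.cell) (hT : ∀ y, C.bd x y ≠ 0 → y ∈ T) :
    ∑ y ∈ T, f (C.bd x y) * f (b y) = f (∑ᶠ y, C.bd x y * b y) := by
  rw [finsum_eq_sum_of_support_subset (s := T), map_sum]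
  · simp
  · intro y hy
    refine hT y fun h => hy ?_
    simp [h]

theorem finite_setOf_deg (C : BasedComplex G) (i : ℕ) : {c | C.deg c = i}.Finite :=
  Set.finite_coe_iff.1 (C.finite_deg i)

theorem finite_bd (C : BasedComplex G) (x : C.cell) : {y | C.bd x y ≠ 0}.Finite := by
  refine Set.Finite.subset (C.finite_setOf_deg (C.deg x - 1)) ?_
  intro y hy
  have : C.deg x = C.deg y + 1 := by
    by_contra h
    exact hy (C.bd_eq_zero _ _ h)
  simp only [Set.mem_ofPred_eq]
  omega

open Classical in
theorem prod_bd_bd {G₁ G₂ : Type*} [Group G₁] [Group G₂] (C₁ : BasedComplex G₁)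
    (C₂ : BasedComplex G₂) (x z : C₁.cell × C₂.cell) :
    ∑ᶠ y : C₁.cell × C₂.cell,
      ((if x.2 = y.2 then
          MonoidAlgebra.mapDomainRingHom ℤ (MonoidHom.inl G₁ G₂) (C₁.bd x.1 y.1) else 0) +
        (if x.1 = y.1 then (-1) ^ C₁.deg x.1 *
          MonoidAlgebra.mapDomainRingHom ℤ (MonoidHom.inr G₁ G₂) (C₂.bd x.2 y.2) else 0)) *
      ((if y.2 = z.2 then
          MonoidAlgebra.mapDomainRingHom ℤ (MonoidHom.inl G₁ G₂) (C₁.bd y.1 z.1) else 0) +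
        (if y.1 = z.1 then (-1) ^ C₁.deg y.1 *
          MonoidAlgebra.mapDomainRingHom ℤ (MonoidHom.inr G₁ G₂) (C₂.bd y.2 z.2) else 0)) = 0 := by
  obtain ⟨x₁, x₂⟩ := x
  obtain ⟨z₁, z₂⟩ := z
  set f := MonoidAlgebra.mapDomainRingHom ℤ (MonoidHom.inl G₁ G₂) with hf
  set g := MonoidAlgebra.mapDomainRingHom ℤ (MonoidHom.inr G₁ G₂) with hg
  have hcomm : ∀ a b, f a * g b = g b * f a := by
    intro a b
    induction a using MonoidAlgebra.induction_on with
    | of u =>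
      induction b using MonoidAlgebra.induction_on with
      | of v => simp [hf, hg, MonoidAlgebra.of_apply, MonoidAlgebra.mapDomain_single,
          MonoidAlgebra.single_mul_single]
      | add a b ha hb => rw [map_add, mul_add, add_mul, ha, hb]
      | smul r a ha => rw [map_zsmul, mul_smul_comm, smul_mul_assoc, ha]
    | add a b ha hb => rw [map_add, mul_add, add_mul, ha, hb]
    | smul r a ha => rw [map_zsmul, mul_smul_comm, smul_mul_assoc, ha]
  let T₁ : Finset C₁.cell := insert x₁ (insert z₁ (C₁.finite_bd x₁).toFinset)
  let T₂ : Finset C₂.cell := insert x₂ (insert z₂ (C₂.finite_bd x₂).toFinset)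
  have hx₁ : x₁ ∈ T₁ := by simp [T₁]
  have hz₁ : z₁ ∈ T₁ := by simp [T₁]
  have hx₂ : x₂ ∈ T₂ := by simp [T₂]
  have hz₂ : z₂ ∈ T₂ := by simp [T₂]
  have hT₁ : ∀ y, C₁.bd x₁ y ≠ 0 → y ∈ T₁ := fun y hy => by simp [T₁, hy]
  have hT₂ : ∀ y, C₂.bd x₂ y ≠ 0 → y ∈ T₂ := fun y hy => by simp [T₂, hy]
  have e₁ : ∑ y ∈ T₁, f (C₁.bd x₁ y) * f (C₁.bd y z₁) = 0 := by
    rw [finsum_bd_mul C₁ f x₁ (fun y => C₁.bd y z₁) T₁ hT₁, C₁.bd_bd, map_zero]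
  have e₂ : ∑ y ∈ T₂, g (C₂.bd x₂ y) * g (C₂.bd y z₂) = 0 := by
    rw [finsum_bd_mul C₂ g x₂ (fun y => C₂.bd y z₂) T₂ hT₂, C₂.bd_bd, map_zero]
  have hsign : f (C₁.bd x₁ z₁) * ((-1) ^ C₁.deg z₁ * g (C₂.bd x₂ z₂)) +
      (-1) ^ C₁.deg x₁ * g (C₂.bd x₂ z₂) * f (C₁.bd x₁ z₁) = 0 := by
    by_cases h : C₁.deg x₁ = C₁.deg z₁ + 1
    · rw [h, pow_succ, mul_assoc _ (g _), ← hcomm]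
      rcases neg_one_pow_eq_or (MonoidAlgebra ℤ (G₁ × G₂)) (C₁.deg z₁) with h' | h' <;>
        simp [h']
    · simp [C₁.bd_eq_zero _ _ h]
  rw [finsum_eq_sum_of_support_subset (s := T₁ ×ˢ T₂)]
  · rw [Finset.sum_product]
    simp only [add_mul, mul_add, Finset.sum_add_distrib, ite_mul, mul_ite, zero_mul, mul_zero]
    have h1 : (∑ y ∈ T₁, ∑ w ∈ T₂, if w = z₂ then
        (if x₂ = w then f (C₁.bd x₁ y) * f (C₁.bd y z₁) else 0) +
          (if x₁ = y then (-1) ^ C₁.deg x₁ * g (C₂.bd x₂ w) * f (C₁.bd y z₁) else 0) else 0) =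
        (-1) ^ C₁.deg x₁ * g (C₂.bd x₂ z₂) * f (C₁.bd x₁ z₁) := by
      simp only [Finset.sum_ite_eq', hz₂, if_true, Finset.sum_add_distrib, Finset.sum_ite_eq, hx₁]
      by_cases h : x₂ = z₂ <;> simp [h, e₁]
    have h2 : (∑ y ∈ T₁, ∑ w ∈ T₂, if y = z₁ then
        (if x₂ = w then f (C₁.bd x₁ y) * ((-1) ^ C₁.deg y * g (C₂.bd w z₂)) else 0) +
          (if x₁ = y then (-1) ^ C₁.deg x₁ * g (C₂.bd x₂ w) *
            ((-1) ^ C₁.deg y * g (C₂.bd w z₂)) else 0) else 0) =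
        f (C₁.bd x₁ z₁) * ((-1) ^ C₁.deg z₁ * g (C₂.bd x₂ z₂)) := by
      rw [Finset.sum_comm]
      simp only [Finset.sum_ite_eq', hz₁, if_true, Finset.sum_add_distrib, Finset.sum_ite_eq, hx₂]
      by_cases h : x₁ = z₁
      · have e₃ : ∀ w, (-1) ^ C₁.deg x₁ * g (C₂.bd x₂ w) * ((-1) ^ C₁.deg z₁ * g (C₂.bd w z₂)) =
            g (C₂.bd x₂ w) * g (C₂.bd w z₂) := by
          intro w
          rw [h]
          rcases neg_one_pow_eq_or (MonoidAlgebra ℤ (G₁ × G₂)) (C₁.deg z₁) with h' | h' <;>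
            simp [h']
        simp only [e₃, if_pos h, e₂, add_zero]
      · simp [h]
    rw [h1, h2, add_comm]
    exact hsign
  · rintro ⟨y₁, y₂⟩ hy
    have hy' := left_ne_zero_of_mul (Function.mem_support.1 hy)
    simp only [Finset.coe_product, Set.mem_prod, Finset.mem_coe]
    by_cases h1 : x₁ = y₁
    · refine ⟨h1 ▸ hx₁, ?_⟩
      by_cases h2 : x₂ = y₂
      · exact h2 ▸ hx₂
      · refine hT₂ _ fun h => hy' ?_
        simp [h2, h]
    · by_cases h2 : x₂ = y₂
      · refine ⟨hT₁ _ fun h => hy' ?_, h2 ▸ hx₂⟩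
        simp [h1, h]
      · exact absurd (by simp [h1, h2]) hy'

open Classical in
/-- The tensor product over `ℤ` of a based complex over `ℤG₁` and a based complex over `ℤG₂`, as a
based complex over `ℤ[G₁ × G₂]`. The basis elements are `e_x ⊗ e_y`, and
`∂(e_x ⊗ e_y) = ∂ e_x ⊗ e_y + (-1)^{deg x} e_x ⊗ ∂ e_y`. -/
def prod {G₁ G₂ : Type*} [Group G₁] [Group G₂] (C₁ : BasedComplex G₁) (C₂ : BasedComplex G₂) :
    BasedComplex (G₁ × G₂) where
  cell := C₁.cell × C₂.cell
  deg x := C₁.deg x.1 + C₂.deg x.2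
  finite_deg i := by
    have h1 : (⋃ j ∈ Set.Iic i, {c | C₁.deg c = j}).Finite :=
      (Set.finite_Iic i).biUnion fun j _ => C₁.finite_setOf_deg j
    have h2 : (⋃ j ∈ Set.Iic i, {c | C₂.deg c = j}).Finite :=
      (Set.finite_Iic i).biUnion fun j _ => C₂.finite_setOf_deg j
    refine Set.Finite.subset (h1.prod h2) ?_
    intro x hx
    have hx' : C₁.deg x.1 + C₂.deg x.2 = i := hx
    simp only [Set.mem_prod, Set.mem_iUnion, Set.mem_Iic, Set.mem_ofPred_eq, exists_prop,
      exists_eq_right']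
    omega
  bd x y :=
    (if x.2 = y.2 then
      MonoidAlgebra.mapDomainRingHom ℤ (MonoidHom.inl G₁ G₂) (C₁.bd x.1 y.1) else 0) +
    (if x.1 = y.1 then
      (-1) ^ C₁.deg x.1 *
        MonoidAlgebra.mapDomainRingHom ℤ (MonoidHom.inr G₁ G₂) (C₂.bd x.2 y.2) else 0)
  bd_eq_zero x y h := by
    have h1 : x.2 = y.2 → C₁.bd x.1 y.1 = 0 := fun e =>
      C₁.bd_eq_zero _ _ fun e' => h (by rw [e, e']; omega)
    have h2 : x.1 = y.1 → C₂.bd x.2 y.2 = 0 := fun e =>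
      C₂.bd_eq_zero _ _ fun e' => h (by rw [e, e']; omega)
    split_ifs with h3 h4 h4 <;> simp_all
  bd_bd x z := prod_bd_bd C₁ C₂ x z

/-- The cellular chain complex of the universal cover of the wedge of two circles, which is the
presentation complex of the free group `F₂`: `0 → (ℤF₂)² → ℤF₂ → 0` with `∂ e_i = x_i - 1`.
The basis element of degree `0` is `none`, those of degree `1` are `some 0` and `some 1`. -/
def freeTwo : BasedComplex (FreeGroup (Fin 2)) where
  cell := Option (Fin 2)
  deg x := x.elim 0 fun _ => 1
  finite_deg _ := inferInstance
  bd
    | some i, none => MonoidAlgebra.of ℤ _ (FreeGroup.of i) - 1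
    | _, _ => 0
  bd_eq_zero x y h := by
    cases x <;> cases y <;> simp_all
  bd_bd x z := by
    refine finsum_eq_zero_of_forall_eq_zero fun y => ?_
    cases x <;> cases y <;> simp

end BasedComplex

/-! ### The group `F₂ × ⋯ × F₂ × F` and its product complex -/

universe u

/-- The group `F₂ × (F₂ × ⋯ × (F₂ × F))` with `n` factors of the free group `F₂`. -/
def ProdGroup (F : Type u) : ℕ → Type u
  | 0 => F
  | n + 1 => FreeGroup (Fin 2) × ProdGroup F n

instance ProdGroup.instGroup (F : Type u) [Group F] : (n : ℕ) → Group (ProdGroup F n)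
  | 0 => inferInstanceAs (Group F)
  | n + 1 =>
    letI := ProdGroup.instGroup F n
    inferInstanceAs (Group (FreeGroup (Fin 2) × ProdGroup F n))

/-- The inclusion of the factor `F` in `F₂ × ⋯ × F₂ × F`. -/
def ProdGroup.incl (F : Type u) [Group F] : (n : ℕ) → F →* ProdGroup F n
  | 0 => MonoidHom.id F
  | n + 1 => (MonoidHom.inr (FreeGroup (Fin 2)) (ProdGroup F n)).comp (ProdGroup.incl F n)

/-- The product complex of `n` copies of the standard complex of `F₂` and a complex `C` for `F`. -/
def prodComplex {F : Type u} [Group F] (C : BasedComplex F) :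
    (n : ℕ) → BasedComplex (ProdGroup F n)
  | 0 => C
  | n + 1 => BasedComplex.freeTwo.prod (prodComplex C n)

/-- A bounded operator has spectral gap at `0` if `0` is not an accumulation point of its
spectrum. -/
def HasSpectralGap {H : Type*} [NormedAddCommGroup H] [NormedSpace ℂ H] (T : H →L[ℂ] H) : Prop :=
  ∃ δ : ℝ, 0 < δ ∧ ∀ z ∈ spectrum ℂ T, z = 0 ∨ δ ≤ ‖z‖

end HigherKazhdan

end

/-!
For a homomorphism `ρ : ℤG → A` into a `*`-algebra, a projection `P` over `A` *splits* a based
complex in degree `i` (`BasedComplex.Splits`) if both coboundaries annihilate it and `1 - P` is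
null-homotopic in degree `i`. Over `A = C*_red(G)` this makes `Δ + P` bounded below
(`Splits.exists_le_inner`), hence invertible; as `Δ P = 0 = P Δ`, the Laplacian has a spectral gap
and `P` is the projection onto its kernel (`Splits.hasSpectralGap`,
`Splits.matOp_eq_kazhdanProjection`). So it is enough to produce a splitting in degree `n` with the
right class in `K₀`, which is a matter of algebra over the fixed `A`; no tensor products of
C*-algebras are needed.

Over a finite group, a resolution of `ℤ` with augmentation `ε : C₀ → ℤ` is split in degree `0` by
`ε ε* / |ε|²` times the averaging projection (`IsResolution.exists_splits`). For each factor `F₂`, let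
`a` be the column with entries `xᵢ - 1`, the coboundary of the complex of `F₂`. If `a* a` is
invertible, then `p = 1 - a (a* a)⁻¹ a*` is a projection in `M₂(A)`, and if `P` splits a complex for
`G'` in degree `n`, then `0 ⊕ (p ⊗ P)` splits the product complex for `F₂ × G'` in degree `n + 1`
(`Splits.prod`). Moreover `[p ⊗ P] = 2 [P] - [P] = [P]`, since `1 - p = v v*` for the isometry
`v = a (a* a)^(-1/2)` (`K0.cls_kronecker`). By induction the class of the splitting in degree `n` is
that of the averaging projection.

The invertibility of `a* a` in `C*_red(G)` is the non-amenability of `F₂`: a count of first letters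
of reduced words shows that `a* a ≥ 1/6` on `ℓ²(G)` (`norm_sq_le_sum_translate`).

Finally the canonical trace of `C*_red(G)` induces a homomorphism on `K₀` that takes the value
`1 / |F|` at the averaging projection and `1` at `[1]` (`cls_average_ne`).
-/

noncomputable section

namespace HigherKazhdan

open Matrix
open scoped Kronecker

/-! ### Kronecker products of matrices with commuting entries -/

section

section Kronecker

variable {A : Type*} [Ring A] {l m n l' m' n' : Type*}

theorem kronecker_mul_kronecker [Fintype m] [Fintype m']
    (M : Matrix l m A) (N : Matrix m n A) (M' : Matrix l' m' A) (N' : Matrix m' n' A)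
    (h : ∀ i j k k', Commute (M' i j) (N k k')) :
    (M ⊗ₖ M') * (N ⊗ₖ N') = (M * N) ⊗ₖ (M' * N') := by
  ext ⟨i, i'⟩ ⟨k, k'⟩
  simp only [mul_apply, kronecker_apply, Fintype.sum_prod_type, Finset.sum_mul_sum]
  refine Finset.sum_congr rfl fun j _ => Finset.sum_congr rfl fun j' _ => ?_
  rw [mul_assoc, ← mul_assoc (M' i' j'), (h i' j' j k).eq]
  simp only [mul_assoc]

theorem conjTranspose_kronecker_of_commute [StarRing A] (M : Matrix l m A) (N : Matrix l' m' A)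
    (h : ∀ i j k k', Commute (M i j) (N k k')) : (M ⊗ₖ N)ᴴ = Mᴴ ⊗ₖ Nᴴ := by
  ext ⟨i, i'⟩ ⟨j, j'⟩
  simp only [conjTranspose_apply, kronecker_apply, ← star_mul, (h _ _ _ _).eq]

theorem neg_kronecker (M : Matrix l m A) (N : Matrix l' m' A) : (-M) ⊗ₖ N = -(M ⊗ₖ N) := by
  ext ⟨i, i'⟩ ⟨j, j'⟩
  simp

theorem kronecker_neg (M : Matrix l m A) (N : Matrix l' m' A) : M ⊗ₖ (-N) = -(M ⊗ₖ N) := by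
  ext ⟨i, i'⟩ ⟨j, j'⟩
  simp

theorem sub_kronecker (M M' : Matrix l m A) (N : Matrix l' m' A) :
    (M - M') ⊗ₖ N = M ⊗ₖ N - M' ⊗ₖ N := by
  rw [sub_eq_add_neg, add_kronecker, neg_kronecker, sub_eq_add_neg]

theorem kronecker_sub (M : Matrix l m A) (N N' : Matrix l' m' A) :
    M ⊗ₖ (N - N') = M ⊗ₖ N - M ⊗ₖ N' := by
  rw [sub_eq_add_neg, kronecker_add, kronecker_neg, sub_eq_add_neg]

end Kronecker

/-! ### A cancellation identity in `K₀` -/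

section KTheory

variable {A : Type*} [Ring A] [StarRing A] {ι κ : Type*} [Fintype ι] [Fintype κ]

theorem K0.cls_eq_of_mvN {p : Matrix ι ι A} {q : Matrix κ κ A} (hp : IsStarProjection p)
    (hq : IsStarProjection q) (h : MvN p q) : K0.cls p hp = K0.cls q hq :=
  congrArg _ ((V.mk_eq_mk hp hq).2 h)

theorem K0.cls_dsum {p : Matrix ι ι A} {q : Matrix κ κ A} (hp : IsStarProjection p)
    (hq : IsStarProjection q) :
    K0.cls (dsum p q) (isStarProjection_dsum hp hq) = K0.cls p hp + K0.cls q hq := by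
  unfold K0.cls
  rw [← map_add, V.mk_add_mk]

theorem mvN_fromBlocks_zero {p : Matrix κ κ A} (hp : IsStarProjection p) :
    MvN (fromBlocks 0 0 0 p : Matrix (ι ⊕ κ) (ι ⊕ κ) A) p := by
  rw [isStarProjection_iff] at hp
  refine ⟨fromCols 0 p, ?_, ?_⟩
  · rw [conjTranspose_fromCols_eq_fromRows_conjTranspose, fromRows_mul_fromCols]
    simp [hp.1, hp.2]
  · rw [conjTranspose_fromCols_eq_fromRows_conjTranspose, fromCols_mul_fromRows]
    simp [hp.1, hp.2]

/-- If `v` is a column isometry, so that `1 - v v*` is a projection of "rank" `|ι| - 1`, and the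
entries of `v` commute with those of a projection `P`, then `[(1 - v v*) ⊗ P] = (|ι| - 1) [P]`;
here `|ι| = 2`. The identity `[(1 - v v*) ⊗ P] + [P] = [1₂ ⊗ P]` is witnessed by the row
`((1 - v v*) ⊗ P, v ⊗ P)`. -/
theorem K0.cls_kronecker {v : Matrix (Fin 2) Unit A} (hv : vᴴ * v = 1)
    {P : Matrix ι ι A} (hP : IsStarProjection P)
    (hc : ∀ i j k l, Commute (v i j) (P k l))
    (h : IsStarProjection ((1 - v * vᴴ) ⊗ₖ P)) :
    K0.cls ((1 - v * vᴴ) ⊗ₖ P) h = K0.cls P hP := by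
  have hP' := isStarProjection_iff.1 hP
  have hc' : ∀ i j k l, Commute (vᴴ i j) (P k l) := by
    intro i j k l
    rw [← hP'.2, conjTranspose_apply, conjTranspose_apply]
    exact (hc j i l k).star_star
  set q : Matrix (Fin 2) (Fin 2) A := 1 - v * vᴴ with hq
  have hqs : qᴴ = q := by simp [hq]
  have hqv : q * v = 0 := by rw [hq, Matrix.sub_mul, Matrix.mul_assoc, hv]; simp
  have hvq : vᴴ * q = 0 := by rw [hq, Matrix.mul_sub, ← Matrix.mul_assoc, hv]; simp
  have hqq : q * q = q := by
    conv_lhs => lhs; rw [hq]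
    rw [Matrix.sub_mul, Matrix.mul_assoc, hvq]; simp
  have hcq : ∀ i j k l, Commute (q i j) (P k l) := by
    intro i j k l
    rw [hq, Matrix.sub_apply, mul_apply]
    refine Commute.sub_left ?_ (Commute.sum_left _ _ _ fun x _ =>
      (hc _ _ _ _).mul_left (hc' _ _ _ _))
    rw [one_apply]
    split_ifs
    · exact Commute.one_left _
    · exact Commute.zero_left _
  have h1P : IsStarProjection ((1 : Matrix Unit Unit A) ⊗ₖ P) := by
    rw [isStarProjection_iff, conjTranspose_kronecker_of_commute, kronecker_mul_kronecker,
      hP'.1, hP'.2]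
    · simp
    all_goals
      intro i j k l
      rw [one_apply]
      split_ifs <;> simp
  have h2P : IsStarProjection ((1 : Matrix (Fin 2) (Fin 2) A) ⊗ₖ P) := by
    rw [isStarProjection_iff, conjTranspose_kronecker_of_commute, kronecker_mul_kronecker,
      hP'.1, hP'.2]
    · simp
    all_goals
      intro i j k l
      rw [one_apply]
      split_ifs <;> simp
  have e1 : K0.cls ((1 : Matrix Unit Unit A) ⊗ₖ P) h1P = K0.cls P hP := by
    refine congrArg _ (V.mk_eq_reindex _ _ (Equiv.punitProd ι).symm ?_)
    ext i j
    simp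
  have e2 : K0.cls ((1 : Matrix (Fin 2) (Fin 2) A) ⊗ₖ P) h2P = K0.cls P hP + K0.cls P hP := by
    rw [← K0.cls_dsum]
    refine congrArg _ (V.mk_eq_reindex _ _
      ((Equiv.boolProdEquivSum ι).symm.trans (finTwoEquiv.symm.prodCongr (Equiv.refl ι))) ?_)
    ext (i | i) (j | j) <;> simp [dsum, finTwoEquiv]
  have e3 : K0.cls (q ⊗ₖ P) h + K0.cls ((1 : Matrix Unit Unit A) ⊗ₖ P) h1P =
      K0.cls ((1 : Matrix (Fin 2) (Fin 2) A) ⊗ₖ P) h2P := by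
    rw [← K0.cls_dsum]
    apply K0.cls_eq_of_mvN
    refine ⟨fromCols (q ⊗ₖ P) (v ⊗ₖ P), ?_, ?_⟩
    · rw [conjTranspose_fromCols_eq_fromRows_conjTranspose, fromRows_mul_fromCols,
        conjTranspose_kronecker_of_commute _ _ hcq, conjTranspose_kronecker_of_commute _ _ hc,
        kronecker_mul_kronecker, kronecker_mul_kronecker, kronecker_mul_kronecker,
        kronecker_mul_kronecker, hqs, hP'.2, hP'.1, hqq, hqv, hvq, hv, dsum]
      · simp
      all_goals
        intro i j k l
        rw [hP'.2]
        first | exact (hcq _ _ _ _).symm | exact (hc _ _ _ _).symm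
    · rw [conjTranspose_fromCols_eq_fromRows_conjTranspose, fromCols_mul_fromRows,
        conjTranspose_kronecker_of_commute _ _ hcq, conjTranspose_kronecker_of_commute _ _ hc,
        kronecker_mul_kronecker, kronecker_mul_kronecker, hqs, hP'.2, hP'.1, hqq, ← add_kronecker,
        hq, sub_add_cancel]
      · intro i j k l
        exact (hc' _ _ _ _).symm
      · intro i j k l
        rw [hqs]
        exact (hcq _ _ _ _).symm
  rw [e1, e2] at e3
  exact add_right_cancel e3

end KTheory

end

/-! ### Cochain complexes with coefficients in a `ℂ`-algebra -/

section

open scoped Classical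

section Bicommutant

variable {A : Type*} [Ring A] [Algebra ℂ A]

/-- The bicommutant in `A` of a set `S`. -/
def bicommutant (S : Set A) : Subalgebra ℂ A :=
  Subalgebra.centralizer ℂ (Set.centralizer S)

theorem mem_bicommutant {S : Set A} {a : A} :
    a ∈ bicommutant S ↔ ∀ c, (∀ b ∈ S, Commute c b) → Commute c a := by
  simp only [bicommutant, Subalgebra.mem_centralizer_iff, Set.mem_centralizer_iff, Commute,
    SemiconjBy]
  exact ⟨fun h c hc => h c fun b hb => (hc b hb).symm,
    fun h c hc => h c fun b hb => (hc b hb).symm⟩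

theorem subset_bicommutant (S : Set A) : S ⊆ bicommutant S :=
  fun _ ha => mem_bicommutant.2 fun _ hc => hc _ ha

theorem bicommutant_le {S T : Set A} (h : S ⊆ bicommutant T) : bicommutant S ≤ bicommutant T :=
  fun _ ha => mem_bicommutant.2 fun c hc => mem_bicommutant.1 ha c fun _ hb =>
    mem_bicommutant.1 (h hb) c hc

theorem bicommutant_comp_le {R S : Type*} [Ring R] [Ring S] (ρ : R →+* A) (f : S →+* R) :
    bicommutant (Set.range (ρ.comp f)) ≤ bicommutant (Set.range ρ) := by
  refine bicommutant_le ?_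
  rintro _ ⟨x, rfl⟩
  exact subset_bicommutant _ ⟨f x, rfl⟩

/-- If two sets commute, so do their bicommutants. -/
theorem commute_of_mem_bicommutant {S T : Set A} (h : ∀ s ∈ S, ∀ t ∈ T, Commute s t) {a b : A}
    (ha : a ∈ bicommutant S) (hb : b ∈ bicommutant T) : Commute a b := by
  refine (mem_bicommutant.1 ha b fun s hs => ?_).symm
  exact (mem_bicommutant.1 hb s fun t ht => h s hs t ht).symm

variable {l m n : Type*} (B : Subalgebra ℂ A)

theorem mul_entries_mem [Fintype m] {M : Matrix l m A} {N : Matrix m n A}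
    (hM : ∀ i j, M i j ∈ B) (hN : ∀ i j, N i j ∈ B) (i : l) (j : n) : (M * N) i j ∈ B := by
  rw [mul_apply]
  exact sum_mem fun k _ => mul_mem (hM _ _) (hN _ _)

theorem one_entries_mem [DecidableEq m] (i j : m) : (1 : Matrix m m A) i j ∈ B := by
  rw [one_apply]
  split_ifs
  exacts [one_mem _, zero_mem _]

end Bicommutant

/-- `t` has an inverse square root in its own bicommutant. -/
def HasInvSqrt {A : Type*} [Ring A] [StarRing A] [Algebra ℂ A] (t : A) : Prop :=
  ∃ s : A, star s = s ∧ s ∈ bicommutant {t} ∧ s * s * t = 1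

namespace BasedComplex

variable {A : Type*} [Ring A] {G : Type*} [Group G]

/-- The basis elements of degree `i - 1`; there are none if `i = 0`. -/
abbrev PrevCells (C : BasedComplex G) (i : ℕ) : Type := {c : C.cell // C.deg c + 1 = i}

instance (C : BasedComplex G) (i : ℕ) : Finite (C.PrevCells i) :=
  ((C.finite_setOf_deg (i - 1)).subset fun c (hc : C.deg c + 1 = i) => by
    simp only [Set.mem_ofPred_eq]; omega).to_subtype

instance (C : BasedComplex G) (i : ℕ) : Fintype (C.PrevCells i) := Fintype.ofFinite _

/-- The coboundary `d_i` with coefficients in `A`, for a ring homomorphism `ρ : ℤG → A`. -/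
def cob (C : BasedComplex G) (ρ : MonoidAlgebra ℤ G →+* A) (i : ℕ) :
    Matrix (C.Cells (i + 1)) (C.Cells i) A :=
  of fun x y => ρ (C.bd x y)

/-- The coboundary `d_{i-1}` with coefficients in `A`; it is the empty matrix if `i = 0`. -/
def cobPrev (C : BasedComplex G) (ρ : MonoidAlgebra ℤ G →+* A) (i : ℕ) :
    Matrix (C.Cells i) (C.PrevCells i) A :=
  of fun x y => ρ (C.bd x y)

/-- The matrix `P` splits off the cohomology in degree `i` of the cochain complex of `C` with
coefficients in `A`: it is annihilated by both coboundaries, and `1 - P` is null-homotopic in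
degree `i`. The entries of the homotopy are asked to lie in the bicommutant of `ρ(ℤG)`, so that they
commute with everything that commutes with `ρ(ℤG)`, in particular with the images of further factors
of a product group. -/
def Splits [Algebra ℂ A] (C : BasedComplex G) (ρ : MonoidAlgebra ℤ G →+* A) (i : ℕ)
    (P : Matrix (C.Cells i) (C.Cells i) A) : Prop :=
  C.cob ρ i * P = 0 ∧ P * C.cobPrev ρ i = 0 ∧
    ∃ (h : Matrix (C.PrevCells i) (C.Cells i) A) (h' : Matrix (C.Cells i) (C.Cells (i + 1)) A),
      (∀ x y, h x y ∈ bicommutant (Set.range ρ)) ∧ (∀ x y, h' x y ∈ bicommutant (Set.range ρ)) ∧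
      C.cobPrev ρ i * h + h' * C.cob ρ i = 1 - P

section Product

variable {G' : Type*} [Group G'] (C : BasedComplex G')

/-- The cells of positive degree of the product of the complex of `F₂` with `C`. -/
def prodCells (m : ℕ) :
    (freeTwo.prod C).Cells (m + 1) ≃ (Unit × C.Cells (m + 1)) ⊕ (Fin 2 × C.Cells m) where
  toFun
    | ⟨(none, y), h⟩ => Sum.inl ((), ⟨y, (Nat.zero_add _).symm.trans h⟩)
    | ⟨(some i, y), h⟩ => Sum.inr (i, ⟨y, Nat.succ_injective ((Nat.add_comm _ _).trans h)⟩)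
  invFun
    | Sum.inl (_, y) => ⟨(none, y.1), (Nat.zero_add _).trans y.2⟩
    | Sum.inr (i, y) => ⟨(some i, y.1), (Nat.add_comm _ _).trans (congrArg Nat.succ y.2)⟩
  left_inv := by rintro ⟨⟨_ | i, y⟩, h⟩ <;> rfl
  right_inv := by rintro (⟨_, y⟩ | ⟨i, y⟩) <;> rfl

/-- The version of `prodCells` for the cells one degree below. -/
def prodPrevCells (m : ℕ) :
    (freeTwo.prod C).PrevCells (m + 1) ≃ (Unit × C.Cells m) ⊕ (Fin 2 × C.PrevCells m) where
  toFun
    | ⟨(none, y), h⟩ => Sum.inl ((), ⟨y, (Nat.zero_add _).symm.trans (Nat.succ_injective h)⟩)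
    | ⟨(some i, y), h⟩ => Sum.inr (i, ⟨y, (Nat.add_comm _ _).trans (Nat.succ_injective h)⟩)
  invFun
    | Sum.inl (_, y) => ⟨(none, y.1), congrArg Nat.succ ((Nat.zero_add _).trans y.2)⟩
    | Sum.inr (i, y) => ⟨(some i, y.1), congrArg Nat.succ ((Nat.add_comm _ _).trans y.2)⟩
  left_inv := by rintro ⟨⟨_ | i, y⟩, h⟩ <;> rfl
  right_inv := by rintro (⟨_, y⟩ | ⟨i, y⟩) <;> rfl

/-- The coboundary of the complex of `F₂`: the column with entries `ρ(xᵢ) - 1`. -/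
def freeCob (ρ : MonoidAlgebra ℤ (FreeGroup (Fin 2)) →+* A) : Matrix (Fin 2) Unit A :=
  of fun i _ => ρ (MonoidAlgebra.of ℤ _ (FreeGroup.of i) - 1)

variable (ρ : MonoidAlgebra ℤ (FreeGroup (Fin 2) × G') →+* A)

/-- The restriction of `ρ` to the free factor. -/
abbrev resFree : MonoidAlgebra ℤ (FreeGroup (Fin 2)) →+* A :=
  ρ.comp (MonoidAlgebra.mapDomainRingHom ℤ (MonoidHom.inl (FreeGroup (Fin 2)) G'))

/-- The restriction of `ρ` to the second factor. -/
abbrev resRight : MonoidAlgebra ℤ G' →+* A :=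
  ρ.comp (MonoidAlgebra.mapDomainRingHom ℤ (MonoidHom.inr (FreeGroup (Fin 2)) G'))

/-- The images of the two factors of a product group commute. -/
theorem commute_resFree_resRight (ρ : MonoidAlgebra ℤ (FreeGroup (Fin 2) × G') →+* A) :
    ∀ s ∈ Set.range (resFree ρ), ∀ t ∈ Set.range (resRight ρ), Commute s t := by
  rintro _ ⟨a, rfl⟩ _ ⟨b, rfl⟩
  refine Commute.map (f := ρ) ?_
  induction a using MonoidAlgebra.induction_on with
  | of u =>
    induction b using MonoidAlgebra.induction_on with
    | of v => simp [MonoidAlgebra.of_apply, Commute, SemiconjBy, MonoidAlgebra.mapDomain_single,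
        MonoidAlgebra.single_mul_single]
    | add a b ha hb => rw [map_add]; exact ha.add_right hb
    | smul r a ha => rw [map_zsmul]; exact ha.smul_right r
  | add a b ha hb => rw [map_add]; exact ha.add_left hb
  | smul r a ha => rw [map_zsmul]; exact ha.smul_left r

theorem map_bd_prod (a b : Option (Fin 2)) (x y : C.cell) :
    ρ ((freeTwo.prod C).bd (a, x) (b, y)) =
      (if x = y then resFree ρ (freeTwo.bd a b) else 0) +
        (if a = b then (-1) ^ freeTwo.deg a * resRight ρ (C.bd x y) else 0) := by
  simp only [prod, map_add, apply_ite ρ, map_mul, map_pow, map_neg, map_one, map_zero,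
    RingHom.comp_apply]
  congr

theorem map_bd_none_none (x y : C.cell) :
    ρ ((freeTwo.prod C).bd (none, x) (none, y)) = resRight ρ (C.bd x y) := by
  rw [map_bd_prod]
  simp [freeTwo]

theorem map_bd_none_some (j : Fin 2) (x y : C.cell) :
    ρ ((freeTwo.prod C).bd (none, x) (some j, y)) = 0 := by
  rw [map_bd_prod]
  simp [freeTwo]

theorem map_bd_some_none (i : Fin 2) (x y : C.cell) :
    ρ ((freeTwo.prod C).bd (some i, x) (none, y)) =
      if x = y then freeCob (resFree ρ) i () else 0 := by
  rw [map_bd_prod]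
  simp [freeTwo, freeCob]

theorem map_bd_some_some (i j : Fin 2) (x y : C.cell) :
    ρ ((freeTwo.prod C).bd (some i, x) (some j, y)) =
      if i = j then -resRight ρ (C.bd x y) else 0 := by
  rw [map_bd_prod]
  simp [freeTwo]

theorem cob_prod (m : ℕ) :
    (freeTwo.prod C).cob ρ (m + 1) =
      (fromBlocks (1 ⊗ₖ C.cob (resRight ρ) (m + 1)) 0 (freeCob (resFree ρ) ⊗ₖ 1)
        (-(1 ⊗ₖ C.cob (resRight ρ) m))).submatrix (prodCells C (m + 1)) (prodCells C m) := by
  ext ⟨⟨_ | i, x⟩, hx⟩ ⟨⟨_ | j, y⟩, hy⟩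
  · refine (map_bd_none_none C ρ x y).trans ?_
    change _ = (1 : Matrix Unit Unit A) () () * resRight ρ (C.bd x y)
    simp
  · exact map_bd_none_some C ρ j x y
  · refine (map_bd_some_none C ρ i x y).trans ?_
    change _ = freeCob (resFree ρ) i () *
      (1 : Matrix (C.Cells (m + 1)) (C.Cells (m + 1)) A) ⟨x, _⟩ ⟨y, _⟩
    simp [one_apply]
  · refine (map_bd_some_some C ρ i j x y).trans ?_
    change _ = -((1 : Matrix (Fin 2) (Fin 2) A) i j * resRight ρ (C.bd x y))
    rw [one_apply]
    split_ifs <;> simp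

theorem cobPrev_prod (m : ℕ) :
    (freeTwo.prod C).cobPrev ρ (m + 1) =
      (fromBlocks (1 ⊗ₖ C.cob (resRight ρ) m) 0 (freeCob (resFree ρ) ⊗ₖ 1)
        (-(1 ⊗ₖ C.cobPrev (resRight ρ) m))).submatrix (prodCells C m) (prodPrevCells C m) := by
  ext ⟨⟨_ | i, x⟩, hx⟩ ⟨⟨_ | j, y⟩, hy⟩
  · refine (map_bd_none_none C ρ x y).trans ?_
    change _ = (1 : Matrix Unit Unit A) () () * resRight ρ (C.bd x y)
    simp
  · exact map_bd_none_some C ρ j x y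
  · refine (map_bd_some_none C ρ i x y).trans ?_
    change _ = freeCob (resFree ρ) i () * (1 : Matrix (C.Cells m) (C.Cells m) A) ⟨x, _⟩ ⟨y, _⟩
    simp [one_apply]
  · refine (map_bd_some_some C ρ i j x y).trans ?_
    change _ = -((1 : Matrix (Fin 2) (Fin 2) A) i j * resRight ρ (C.bd x y))
    rw [one_apply]
    split_ifs <;> simp

end Product

end BasedComplex

end

/-! ### Splittings of product complexes -/

section

open scoped Classical

namespace BasedComplex

variable {A : Type*} [Ring A] [StarRing A] [Algebra ℂ A] {G' : Type*} [Group G']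

/-- The polar decomposition of the coboundary of the complex of `F₂`: if its Laplacian `a* a` has an
inverse square root, then `a` has a left inverse `e` such that `a e` is the range projection
`v v*` of an isometry `v`. -/
theorem exists_isometry (ρ : MonoidAlgebra ℤ (FreeGroup (Fin 2)) →+* A)
    (hρ : ∀ g, star (ρ (MonoidAlgebra.of ℤ _ g)) = ρ (MonoidAlgebra.of ℤ _ g⁻¹))
    (h : HasInvSqrt (((freeCob ρ)ᴴ * freeCob ρ) () ())) :
    ∃ (v : Matrix (Fin 2) Unit A) (e : Matrix Unit (Fin 2) A),
      (∀ i j, v i j ∈ bicommutant (Set.range ρ)) ∧ (∀ i j, vᴴ i j ∈ bicommutant (Set.range ρ)) ∧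
      (∀ i j, e i j ∈ bicommutant (Set.range ρ)) ∧
      vᴴ * v = 1 ∧ e * freeCob ρ = 1 ∧ freeCob ρ * e = v * vᴴ := by
  obtain ⟨s, hs, hsB, hst⟩ := h
  set a := freeCob ρ with ha
  have haB : ∀ i j, a i j ∈ bicommutant (Set.range ρ) :=
    fun i j => subset_bicommutant _ ⟨_, rfl⟩
  have haB' : ∀ i j, aᴴ i j ∈ bicommutant (Set.range ρ) := by
    intro i j
    refine subset_bicommutant _ ⟨MonoidAlgebra.of ℤ _ (FreeGroup.of j)⁻¹ - 1, ?_⟩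
    rw [conjTranspose_apply, ha, freeCob, of_apply, map_sub, map_sub, star_sub, hρ]
    simp
  have hsB' : s ∈ bicommutant (Set.range ρ) :=
    bicommutant_le (Set.singleton_subset_iff.2 (mul_entries_mem _ haB' haB () ())) hsB
  have hcomm : Commute s ((aᴴ * a) () ()) :=
    (mem_bicommutant.1 hsB _ fun b hb => by rw [Set.mem_singleton_iff.1 hb]).symm
  set S : Matrix Unit Unit A := of fun _ _ => s with hS
  have hSB : ∀ i j, S i j ∈ bicommutant (Set.range ρ) := fun _ _ => hsB'
  have hSS : Sᴴ = S := by ext; simp [hS, hs]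
  have hT : aᴴ * a = of fun _ _ => (aᴴ * a) () () := by
    ext ⟨⟩ ⟨⟩
    rfl
  generalize (aᴴ * a) () () = t at hst hcomm hT
  have h1 : S * S * (aᴴ * a) = 1 := by
    rw [hT]
    ext ⟨⟩ ⟨⟩
    simpa [hS, mul_apply] using hst
  have h2 : S * (aᴴ * a) = aᴴ * a * S := by
    rw [hT]
    ext ⟨⟩ ⟨⟩
    simpa [hS, mul_apply] using hcomm.eq
  have hv : (a * S)ᴴ = S * aᴴ := by rw [conjTranspose_mul, hSS]
  refine ⟨a * S, S * S * aᴴ, mul_entries_mem _ haB hSB, ?_,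
    mul_entries_mem _ (mul_entries_mem _ hSB hSB) haB', ?_, ?_, ?_⟩
  · rw [hv]
    exact mul_entries_mem _ hSB haB'
  · rw [hv, ← h1]
    simp only [Matrix.mul_assoc] at h2 ⊢
    rw [h2]
  · rw [Matrix.mul_assoc, h1]
  · rw [hv]
    simp only [Matrix.mul_assoc]

/-- Passing from `G'` to `F₂ × G'` raises the degree of a splitting by one: if `P` splits off the
cohomology of `C` in degree `n`, then `0 ⊕ (p ⊗ P)` splits off that of the product complex in degree
`n + 1`, where `p = 1 - a (a* a)⁻¹ a*` and `a` is the coboundary of the complex of `F₂`. -/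
theorem Splits.prod (C : BasedComplex G') (ρ : MonoidAlgebra ℤ (FreeGroup (Fin 2) × G') →+* A)
    (hρ : ∀ g, star (ρ (MonoidAlgebra.of ℤ _ g)) = ρ (MonoidAlgebra.of ℤ _ g⁻¹))
    (h : HasInvSqrt (((freeCob (resFree ρ))ᴴ * freeCob (resFree ρ)) () ()))
    {n : ℕ} {P : Matrix (C.Cells n) (C.Cells n) A} (hP : IsStarProjection P)
    (hPB : ∀ x y, P x y ∈ bicommutant (Set.range (resRight ρ)))
    (hC : C.Splits (resRight ρ) n P) :
    ∃ (Q : Matrix ((freeTwo.prod C).Cells (n + 1)) ((freeTwo.prod C).Cells (n + 1)) A)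
      (hQ : IsStarProjection Q), (∀ x y, Q x y ∈ bicommutant (Set.range ρ)) ∧
      (freeTwo.prod C).Splits ρ (n + 1) Q ∧ K0.cls Q hQ = K0.cls P hP := by
  obtain ⟨v, e, hvB, hvB', heB, hv, hea, hae⟩ := exists_isometry (resFree ρ) (fun g => by
    simpa using hρ (g, 1)) h
  obtain ⟨hC1, hC2, k, k', hkB, hk'B, hk⟩ := hC
  set a := freeCob (resFree ρ) with ha
  set B := bicommutant (Set.range (resFree ρ)) with hB
  set B' := bicommutant (Set.range (resRight ρ)) with hB'
  have hc : ∀ {x y : A}, x ∈ B → y ∈ B' → Commute x y := fun hx hy =>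
    commute_of_mem_bicommutant (commute_resFree_resRight ρ) hx hy
  have hc' : ∀ {x y : A}, x ∈ B' → y ∈ B → Commute x y := fun hx hy => (hc hy hx).symm
  set p : Matrix (Fin 2) (Fin 2) A := 1 - v * vᴴ with hp
  have haB : ∀ i j, a i j ∈ B := fun i j => subset_bicommutant _ ⟨_, rfl⟩
  have hpB : ∀ i j, p i j ∈ B := fun i j =>
    sub_mem (one_entries_mem _ _ _) (mul_entries_mem _ hvB hvB' _ _)
  have hps : pᴴ = p := by simp [hp]
  have hpp : p * p = p := by
    have : v * vᴴ * (v * vᴴ) = v * vᴴ := by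
      rw [Matrix.mul_assoc, ← Matrix.mul_assoc vᴴ, hv, Matrix.one_mul]
    rw [hp, Matrix.sub_mul, Matrix.mul_sub (v * vᴴ), this]
    simp
  have hpa : p * a = 0 := by
    rw [hp, Matrix.sub_mul, ← hae, Matrix.mul_assoc, hea]
    simp
  have hcobB : ∀ i x y, C.cob (resRight ρ) i x y ∈ B' := fun i x y =>
    subset_bicommutant _ ⟨_, rfl⟩
  have hcobPB : ∀ x y, C.cobPrev (resRight ρ) n x y ∈ B' := fun x y =>
    subset_bicommutant _ ⟨_, rfl⟩
  have hP' := isStarProjection_iff.1 hP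
  have hpP : IsStarProjection (p ⊗ₖ P) := by
    rw [isStarProjection_iff, conjTranspose_kronecker_of_commute, kronecker_mul_kronecker,
      hP'.1, hP'.2, hpp, hps]
    · exact ⟨rfl, rfl⟩
    · exact fun i j k l => hc' (hPB _ _) (hpB _ _)
    · exact fun i j k l => hc (hpB _ _) (hPB _ _)
  let Q' : Matrix ((Unit × C.Cells (n + 1)) ⊕ (Fin 2 × C.Cells n))
      ((Unit × C.Cells (n + 1)) ⊕ (Fin 2 × C.Cells n)) A :=
    fromBlocks 0 0 0 (p ⊗ₖ P)
  have hQ' : IsStarProjection Q' := by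
    rw [isStarProjection_iff] at hpP ⊢
    simp [Q', fromBlocks_multiply, fromBlocks_conjTranspose, hpP.1, hpP.2]
  have hQ := isStarProjection_reindex hQ' (prodCells C n)
  have hB1 : B ≤ bicommutant (Set.range ρ) := bicommutant_comp_le _ _
  have hB2 : B' ≤ bicommutant (Set.range ρ) := bicommutant_comp_le _ _
  refine ⟨Q'.submatrix (prodCells C n) (prodCells C n), hQ, ?_, ⟨?_, ?_, ?_⟩, ?_⟩
  · intro x y
    rw [submatrix_apply]
    rcases prodCells C n x with x | x <;> rcases prodCells C n y with y | y
    · exact zero_mem _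
    · exact zero_mem _
    · exact zero_mem _
    · exact mul_mem (hB1 (hpB _ _)) (hB2 (hPB _ _))
  · have h1 : (1 ⊗ₖ C.cob (resRight ρ) n :
        Matrix (Fin 2 × C.Cells (n + 1)) (Fin 2 × C.Cells n) A) * (p ⊗ₖ P) = 0 := by
      rw [kronecker_mul_kronecker, hC1, kronecker_zero]
      exact fun i j k l => hc' (hcobB _ _ _) (hpB _ _)
    rw [cob_prod, submatrix_mul_equiv, fromBlocks_multiply]
    simp [h1]
  · have h1 : (p ⊗ₖ P) * (1 ⊗ₖ C.cobPrev (resRight ρ) n :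
        Matrix (Fin 2 × C.Cells n) (Fin 2 × C.PrevCells n) A) = 0 := by
      rw [kronecker_mul_kronecker, hC2, kronecker_zero]
      exact fun i j k l => hc' (hPB _ _) (one_entries_mem _ _ _)
    have h2 : (p ⊗ₖ P) * (a ⊗ₖ (1 : Matrix (C.Cells n) (C.Cells n) A)) = 0 := by
      rw [kronecker_mul_kronecker, hpa, zero_kronecker]
      exact fun i j k l => hc' (hPB _ _) (haB _ _)
    rw [cobPrev_prod, submatrix_mul_equiv, fromBlocks_multiply]
    simp [h1, h2, ← ha]
  -- The homotopy is `(f, g) ↦ (e g, -(p ⊗ k) g)`: its first component reduces the complex to the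
  -- range of `p ⊗ 1`, a shifted copy of that of `C` with the opposite sign.
  · refine ⟨(fromBlocks 0 (e ⊗ₖ 1) 0 (-(p ⊗ₖ k))).submatrix (prodPrevCells C n) (prodCells C n),
      (fromBlocks 0 (e ⊗ₖ 1) 0 (-(p ⊗ₖ k'))).submatrix (prodCells C n) (prodCells C (n + 1)),
      ?_, ?_, ?_⟩
    · intro x y
      rw [submatrix_apply]
      rcases prodPrevCells C n x with x | x <;> rcases prodCells C n y with y | y
      · exact zero_mem _
      · exact mul_mem (hB1 (heB _ _)) (one_entries_mem _ _ _)
      · exact zero_mem _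
      · exact neg_mem (mul_mem (hB1 (hpB _ _)) (hB2 (hkB _ _)))
    · intro x y
      rw [submatrix_apply]
      rcases prodCells C n x with x | x <;> rcases prodCells C (n + 1) y with y | y
      · exact zero_mem _
      · exact mul_mem (hB1 (heB _ _)) (one_entries_mem _ _ _)
      · exact zero_mem _
      · exact neg_mem (mul_mem (hB1 (hpB _ _)) (hB2 (hk'B _ _)))
    · have h1 : (1 ⊗ₖ C.cob (resRight ρ) n :
          Matrix (Unit × C.Cells (n + 1)) (Unit × C.Cells n) A) *
          (e ⊗ₖ (1 : Matrix (C.Cells n) (C.Cells n) A)) =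
          e ⊗ₖ C.cob (resRight ρ) n := by
        rw [kronecker_mul_kronecker, Matrix.one_mul, Matrix.mul_one]
        exact fun i j k l => hc' (hcobB _ _ _) (heB _ _)
      have h2 : (a ⊗ₖ (1 : Matrix (C.Cells n) (C.Cells n) A)) *
          (e ⊗ₖ (1 : Matrix (C.Cells n) (C.Cells n) A)) = (1 - p) ⊗ₖ 1 := by
        rw [kronecker_mul_kronecker, hae, Matrix.mul_one, hp, sub_sub_cancel]
        exact fun i j k l => hc' (one_entries_mem _ _ _) (heB _ _)
      have h3 : (1 ⊗ₖ C.cobPrev (resRight ρ) n :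
            Matrix (Fin 2 × C.Cells n) (Fin 2 × C.PrevCells n) A) * (p ⊗ₖ k) =
          p ⊗ₖ (C.cobPrev (resRight ρ) n * k) := by
        rw [kronecker_mul_kronecker, Matrix.one_mul]
        exact fun i j k l => hc' (hcobPB _ _) (hpB _ _)
      have h4 : (e ⊗ₖ (1 : Matrix (C.Cells (n + 1)) (C.Cells (n + 1)) A)) *
          (a ⊗ₖ (1 : Matrix (C.Cells (n + 1)) (C.Cells (n + 1)) A)) = 1 := by
        rw [kronecker_mul_kronecker, hea, Matrix.mul_one, one_kronecker_one]
        exact fun i j k l => hc' (one_entries_mem _ _ _) (haB _ _)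
      have h5 : (e ⊗ₖ (1 : Matrix (C.Cells (n + 1)) (C.Cells (n + 1)) A)) *
          (1 ⊗ₖ C.cob (resRight ρ) n :
            Matrix (Fin 2 × C.Cells (n + 1)) (Fin 2 × C.Cells n) A) =
          e ⊗ₖ C.cob (resRight ρ) n := by
        rw [kronecker_mul_kronecker, Matrix.one_mul, Matrix.mul_one]
        exact fun i j k l => hc' (one_entries_mem _ _ _) (one_entries_mem _ _ _)
      have h6 : (p ⊗ₖ k') * (a ⊗ₖ (1 : Matrix (C.Cells (n + 1)) (C.Cells (n + 1)) A)) = 0 := by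
        rw [kronecker_mul_kronecker, hpa, zero_kronecker]
        exact fun i j k l => hc' (hk'B _ _) (haB _ _)
      have h7 : (p ⊗ₖ k') * (1 ⊗ₖ C.cob (resRight ρ) n :
            Matrix (Fin 2 × C.Cells (n + 1)) (Fin 2 × C.Cells n) A) =
          p ⊗ₖ (k' * C.cob (resRight ρ) n) := by
        rw [kronecker_mul_kronecker, Matrix.mul_one]
        exact fun i j k l => hc' (hk'B _ _) (one_entries_mem _ _ _)
      have h8 : (1 - p) ⊗ₖ (1 : Matrix (C.Cells n) (C.Cells n) A) +
          p ⊗ₖ (C.cobPrev (resRight ρ) n * k) + p ⊗ₖ (k' * C.cob (resRight ρ) n) =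
          1 - p ⊗ₖ P := by
        rw [add_assoc, ← kronecker_add, hk, kronecker_sub, sub_kronecker, one_kronecker_one]
        abel
      have h9 : (1 : Matrix ((freeTwo.prod C).Cells (n + 1)) ((freeTwo.prod C).Cells (n + 1)) A) -
          Q'.submatrix (prodCells C n) (prodCells C n) =
          (fromBlocks 1 0 0 (1 - p ⊗ₖ P)).submatrix (prodCells C n) (prodCells C n) := by
        rw [← submatrix_one_equiv (prodCells C n)]
        change (1 - Q').submatrix _ _ = _
        congr 1
        rw [← fromBlocks_one]
        ext (i | i) (j | j) <;> simp [Q', one_apply]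
      rw [h9, cob_prod, cobPrev_prod, submatrix_mul_equiv, submatrix_mul_equiv,
        fromBlocks_multiply, fromBlocks_multiply]
      refine (congrFun (congrFun (submatrix_add _ _) _) _).symm.trans ?_
      rw [fromBlocks_add]
      simp only [Matrix.mul_zero, Matrix.zero_mul, Matrix.mul_neg, Matrix.neg_mul, neg_neg,
        zero_add, add_zero, h1, h2, h3, h4, h5, h6, h7, h8, add_neg_cancel, neg_zero, ← ha]
  · have hcls : K0.cls (Q'.submatrix (prodCells C n) (prodCells C n)) hQ = K0.cls Q' hQ' :=
      K0.cls_eq_of_mvN _ _ (MvN.reindex hQ' _).symm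
    rw [hcls, K0.cls_eq_of_mvN hQ' hpP (mvN_fromBlocks_zero hpP)]
    exact K0.cls_kronecker hv hP (fun i j k l => hc (hvB _ _) (hPB _ _)) hpP

end BasedComplex

end

/-! ### Resolutions over finite groups -/

section

open scoped Classical

section Finite

variable {A : Type*} [Ring A] [Algebra ℂ A]
  {F : Type*} [Group F] [Fintype F] (ρ : MonoidAlgebra ℤ F →+* A)

theorem map_mul_average (x : MonoidAlgebra ℤ F) :
    ρ x * ((Fintype.card F : ℂ)⁻¹ • ∑ g : F, ρ (MonoidAlgebra.of ℤ F g)) =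
      BasedComplex.aug x • ((Fintype.card F : ℂ)⁻¹ • ∑ g : F, ρ (MonoidAlgebra.of ℤ F g)) := by
  induction x using MonoidAlgebra.induction_on with
  | of g =>
    rw [mul_smul_comm, Finset.mul_sum,
      ← Equiv.sum_comp (Equiv.mulLeft g) (fun h => ρ (MonoidAlgebra.of ℤ F h))]
    simp only [← map_mul, Equiv.coe_mulLeft]
    simp [BasedComplex.aug, MonoidAlgebra.of_apply]
  | add a b ha hb => rw [map_add, add_mul, ha, hb, map_add, add_smul]
  | smul r a ha => rw [map_zsmul, smul_mul_assoc, ha, map_zsmul, smul_assoc]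

theorem one_sub_average :
    1 - (Fintype.card F : ℂ)⁻¹ • ∑ g : F, ρ (MonoidAlgebra.of ℤ F g) =
      (Fintype.card F : ℂ)⁻¹ • ∑ g : F, ρ (1 - MonoidAlgebra.of ℤ F g) := by
  have hc : (Fintype.card F : ℂ) ≠ 0 := Nat.cast_ne_zero.2 Fintype.card_ne_zero
  simp only [map_sub, map_one, Finset.sum_sub_distrib, smul_sub]
  rw [Finset.sum_const, Finset.card_univ, ← Nat.cast_smul_eq_nsmul ℂ, smul_smul,
    inv_mul_cancel₀ hc, one_smul]

variable [StarRing A] [StarModule ℂ A]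

/-- In degree `0`, a resolution `⋯ → C₁ → C₀ → ℤ` over the group ring of a finite group is split
by the rank one projection `ε ε* / |ε|²` times the averaging projection, where `ε` is the
augmentation `C₀ → ℤ`. -/
theorem BasedComplex.IsResolution.exists_splits {C : BasedComplex F} (hC : C.IsResolution)
    {N : A} (hN : IsStarProjection N)
    (hNF : N = (Fintype.card F : ℂ)⁻¹ • ∑ g : F, ρ (MonoidAlgebra.of ℤ F g)) :
    ∃ (P : Matrix (C.Cells 0) (C.Cells 0) A) (hP : IsStarProjection P),
      (∀ x y, P x y ∈ bicommutant (Set.range ρ)) ∧ C.Splits ρ 0 P ∧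
      K0.cls P hP = K0.cls₁ N hN := by
  obtain ⟨ε, ⟨x, hx⟩, hker, -⟩ := hC
  have hNN : N * N = N := hN.isIdempotentElem
  have hNs : star N = N := hN.isSelfAdjoint
  have hNB : N ∈ bicommutant (Set.range ρ) := by
    rw [hNF]
    exact Subalgebra.smul_mem _ (sum_mem fun g _ => subset_bicommutant _ (Set.mem_range_self _)) _
  set q : ℂ := ∑ c, (ε c : ℂ) * ε c with hq
  have hq0 : q ≠ 0 := by
    intro h0
    have h1 : ((∑ c, ε c * ε c : ℤ) : ℂ) = 0 := by push_cast; exact h0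
    have h2 : ∀ c, ε c = 0 := by
      intro c
      have := (Finset.sum_eq_zero_iff_of_nonneg fun c _ => mul_self_nonneg (ε c)).1
        (Int.cast_eq_zero.1 h1) c (Finset.mem_univ c)
      exact mul_self_eq_zero.1 this
    simp [h2] at hx
  -- `q` is a nonnegative real, so it has a real square root.
  obtain ⟨r, hr, hrs⟩ : ∃ r : ℂ, r * r = q ∧ star r = r := by
    refine ⟨(Real.sqrt (∑ c, (ε c : ℝ) * ε c) : ℝ), ?_, by simp⟩
    rw [← Complex.ofReal_mul, Real.mul_self_sqrt (Finset.sum_nonneg fun c _ => mul_self_nonneg _)]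
    simp [hq]
  have hr0 : r ≠ 0 := by rintro rfl; exact hq0 (by rw [← hr, mul_zero])
  let P : Matrix (C.Cells 0) (C.Cells 0) A :=
    of fun c c' => (q⁻¹ * (ε c * ε c') : ℂ) • N
  have hv : MvN P (of fun _ _ : Unit => N) := by
    refine ⟨of fun _ c => (r⁻¹ * ε c : ℂ) • N, ?_, ?_⟩
    · ext1 c c'
      simp only [mul_apply, conjTranspose_apply, of_apply, Finset.univ_unique, Finset.sum_const,
        Finset.card_singleton, one_smul, star_smul, hNs, smul_mul_smul_comm, hNN, P]
      congr 1
      simp only [star_mul', star_inv₀, hrs, star_intCast, ← hr]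
      field_simp
    · ext1 c c'
      simp only [mul_apply, conjTranspose_apply, of_apply, star_smul, hNs, smul_mul_smul_comm, hNN,
        ← Finset.sum_smul]
      convert one_smul ℂ N
      have : ∀ k, r⁻¹ * (ε k : ℂ) * star (r⁻¹ * (ε k : ℂ)) = q⁻¹ * (ε k * ε k) := by
        intro k
        simp only [star_mul', star_inv₀, hrs, star_intCast]
        rw [← hr]
        field_simp
      simp only [this, ← Finset.mul_sum, ← hq]
      exact inv_mul_cancel₀ hq0
  have hP : IsStarProjection P := by
    rw [isStarProjection_iff]
    constructor
    · ext1 c c'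
      simp only [P, mul_apply, of_apply, smul_mul_smul_comm, hNN, ← Finset.sum_smul]
      congr 1
      have : ∀ k, q⁻¹ * ((ε c : ℂ) * ε k) * (q⁻¹ * (ε k * ε c')) =
          q⁻¹ * (ε c * ε c') * q⁻¹ * (ε k * ε k) := fun k => by ring
      simp only [this, ← Finset.mul_sum, ← hq]
      field_simp
    · ext1 c c'
      simp only [P, conjTranspose_apply, of_apply, star_smul, hNs]
      congr 1
      simp only [star_mul', star_inv₀, star_intCast]
      rw [← hr, star_mul', hrs]
      ring
  have hPB : ∀ x y, P x y ∈ bicommutant (Set.range ρ) := fun x y =>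
    Subalgebra.smul_mem _ hNB _
  -- The rows `e_c - ε c x` and `(1 - g) x` lie in the kernel of `ε`, so they are boundaries.
  have hy : ∀ c, ∃ y, y ᵥ* C.D 0 = Pi.single c 1 - ε c • x := by
    intro c
    refine (hker _).1 ?_
    have : ∀ k, BasedComplex.aug ((Pi.single c 1 - ε c • x : C.Cells 0 → _) k) * ε k =
        (if k = c then ε k else 0) - ε c * (BasedComplex.aug (x k) * ε k) := by
      intro k
      rw [Pi.sub_apply, map_sub, sub_mul, Pi.smul_apply, map_zsmul, smul_eq_mul, mul_assoc,
        Pi.single_apply]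
      split_ifs <;> simp
    simp only [this, Finset.sum_sub_distrib, ← Finset.mul_sum, hx]
    simp
  choose y hy using hy
  have hz : ∀ g : F, ∃ z, z ᵥ* C.D 0 = fun c => (1 - MonoidAlgebra.of ℤ F g) * x c := by
    intro g
    refine (hker _).1 (Finset.sum_eq_zero fun c _ => ?_)
    rw [map_mul, map_sub]
    simp [BasedComplex.aug, MonoidAlgebra.of_apply]
  choose z hz using hz
  have hD : ∀ a : C.Cells 1, ∑ c, BasedComplex.aug (C.D 0 a c) * ε c = 0 := by
    intro a
    refine (hker (fun c => C.D 0 a c)).2 ⟨Pi.single a 1, ?_⟩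
    rw [single_one_vecMul]
    rfl
  set d := C.cob ρ 0 with hd
  let E : Matrix (C.Cells 0) Unit A := of fun c _ => (ε c : A)
  let X : Matrix Unit (C.Cells 0) A := of fun _ c => ρ (x c)
  let Y : Matrix (C.Cells 0) (C.Cells 1) A := of fun c a => ρ (y c a)
  let Z : Matrix Unit (C.Cells 1) A :=
    of fun _ a => (Fintype.card F : ℂ)⁻¹ • ∑ g, ρ (z g a)
  have hY : Y * d = 1 - E * X := by
    ext1 c c'
    have h := congrArg ρ (congrFun (hy c) c')
    simp only [vecMul, dotProduct, map_sum, map_mul, Pi.sub_apply, map_sub, Pi.smul_apply,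
      map_zsmul, Pi.single_apply] at h
    refine (mul_apply ..).trans (h.trans ?_)
    rw [Matrix.sub_apply, mul_apply, one_apply]
    simp only [E, X, of_apply, Finset.univ_unique, Finset.sum_const, Finset.card_singleton,
      one_smul, zsmul_eq_mul, eq_comm (a := c)]
    split_ifs <;> simp
  have hZ : Z * d = of fun _ c => (1 - N) * ρ (x c) := by
    ext1 u c
    rw [mul_apply, of_apply, hNF, one_sub_average, smul_mul_assoc, Finset.sum_mul]
    simp only [Z, of_apply, smul_mul_assoc, ← Finset.smul_sum, Finset.sum_mul]
    rw [Finset.sum_comm]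
    congr 1
    refine Finset.sum_congr rfl fun g _ => ?_
    have h := congrArg ρ (congrFun (hz g) c)
    simp only [vecMul, dotProduct, map_sum, map_mul] at h
    exact h
  have hPE : P * E = of fun c _ => (ε c : A) * N := by
    ext1 c u
    have : ∀ k, ((q⁻¹ * (ε c * ε k) : ℂ) • N) * (ε k : A) =
        ((q⁻¹ * ε c) * (ε k * ε k) : ℂ) • N := by
      intro k
      rw [← (Int.cast_commute (ε k) _).eq, ← zsmul_eq_mul, ← Int.cast_smul_eq_zsmul ℂ, smul_smul]
      congr 1
      ring
    simp only [mul_apply, P, E, of_apply, this, ← Finset.sum_smul, ← Finset.mul_sum, ← hq]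
    rw [← zsmul_eq_mul, ← Int.cast_smul_eq_zsmul ℂ]
    congr 1
    field_simp
  have hEX : (1 - P) * (E * X) = E * (Z * d) := by
    rw [← Matrix.mul_assoc, Matrix.sub_mul, Matrix.one_mul, hPE, hZ]
    ext1 c c'
    simp only [mul_apply, E, X, Matrix.sub_apply, of_apply, Finset.univ_unique, Finset.sum_const,
      Finset.card_singleton, one_smul]
    noncomm_ring
  refine ⟨P, hP, hPB, ⟨?_, ?_, 0, (1 - P) * Y + E * Z, ?_, ?_, ?_⟩, ?_⟩
  · ext1 a c'
    have : ∀ c, d a c * P c c' =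
        (q⁻¹ * ε c' * ((BasedComplex.aug (C.D 0 a c) * ε c : ℤ) : ℂ)) • N := by
      intro c
      change ρ (C.D 0 a c) * (q⁻¹ * (ε c * ε c') : ℂ) • N = _
      rw [mul_smul_comm, hNF, map_mul_average, ← hNF, ← Int.cast_smul_eq_zsmul ℂ, smul_smul]
      congr 1
      push_cast
      ring
    refine (mul_apply ..).trans ((Finset.sum_congr rfl fun c _ => this c).trans ?_)
    rw [← Finset.sum_smul, ← Finset.mul_sum, ← Int.cast_sum, hD]
    simp
  · ext1 c a
    exact absurd a.2 (Nat.succ_ne_zero _)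
  · exact fun _ _ => zero_mem _
  · have hYB : ∀ c a, Y c a ∈ bicommutant (Set.range ρ) := fun c a =>
      subset_bicommutant _ ⟨_, rfl⟩
    have hZB : ∀ c a, Z c a ∈ bicommutant (Set.range ρ) := fun c a =>
      Subalgebra.smul_mem _ (sum_mem fun g _ => subset_bicommutant _ (Set.mem_range_self _)) _
    have hEB : ∀ c a, E c a ∈ bicommutant (Set.range ρ) := fun c a => intCast_mem _ _
    exact fun c a => add_mem (mul_entries_mem _ (fun k l => sub_mem (one_entries_mem _ _ _)
      (hPB k l)) hYB _ _) (mul_entries_mem _ hEB hZB _ _)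
  · rw [Matrix.mul_zero, zero_add, Matrix.add_mul, Matrix.mul_assoc, Matrix.mul_assoc, hY, ← hEX,
      ← Matrix.mul_add, sub_add_cancel, Matrix.mul_one]
  · exact K0.cls_eq_of_mvN _ _ hv

end Finite

open BasedComplex in
/-- The splitting of the product complex in degree `n`, provided that the Laplacian in degree `0` of
every retract of the group isomorphic to `F₂` has an inverse square root. -/
theorem exists_splits_prodComplex {A : Type*} [Ring A] [StarRing A] [Algebra ℂ A] [StarModule ℂ A]
    {F : Type*} [Group F] [Fintype F] {C : BasedComplex F} (hC : C.IsResolution) (n : ℕ)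
    (ρ : MonoidAlgebra ℤ (ProdGroup F n) →+* A)
    (hρ : ∀ g, star (ρ (MonoidAlgebra.of ℤ _ g)) = ρ (MonoidAlgebra.of ℤ _ g⁻¹))
    (hgap : ∀ (i : FreeGroup (Fin 2) →* ProdGroup F n) (r : ProdGroup F n →* FreeGroup (Fin 2)),
      (∀ w, r (i w) = w) →
      HasInvSqrt (((freeCob (ρ.comp (MonoidAlgebra.mapDomainRingHom ℤ i)))ᴴ *
        freeCob (ρ.comp (MonoidAlgebra.mapDomainRingHom ℤ i))) () ()))
    {N : A} (hN : IsStarProjection N)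
    (hNF : N = (Fintype.card F : ℂ)⁻¹ •
      ∑ g : F, ρ (MonoidAlgebra.of ℤ _ (ProdGroup.incl F n g))) :
    ∃ (P : Matrix ((prodComplex C n).Cells n) ((prodComplex C n).Cells n) A)
      (hP : IsStarProjection P), (∀ x y, P x y ∈ bicommutant (Set.range ρ)) ∧
      (prodComplex C n).Splits ρ n P ∧ K0.cls P hP = K0.cls₁ N hN := by
  induction n with
  | zero => exact IsResolution.exists_splits (F := F) ρ hC hN hNF
  | succ n ih =>
    let ρ' : MonoidAlgebra ℤ (FreeGroup (Fin 2) × ProdGroup F n) →+* A := ρ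
    obtain ⟨P, hP, hPB, hPS, hcls⟩ := ih (resRight ρ')
      (fun g => by
        simp only [resRight, RingHom.comp_apply, MonoidAlgebra.mapDomainRingHom_apply,
          MonoidAlgebra.of_apply, MonoidAlgebra.mapDomain_single]
        refine (hρ (MonoidHom.inr _ _ g)).trans ?_
        exact congrArg (fun x => ρ' (MonoidAlgebra.of ℤ _ x))
          (map_inv (MonoidHom.inr (FreeGroup (Fin 2)) (ProdGroup F n)) g).symm)
      (fun i r hr => by
        have := hgap ((MonoidHom.inr _ _).comp i) (r.comp (MonoidHom.snd _ _)) (fun w => hr w)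
        rw [RingHom.comp_assoc, ← MonoidAlgebra.mapDomainRingHom_comp]
        exact this)
      (by
        rw [hNF]
        congr 1
        refine Finset.sum_congr rfl fun g _ => ?_
        simp only [resRight, RingHom.comp_apply, MonoidAlgebra.mapDomainRingHom_apply,
          MonoidAlgebra.of_apply, MonoidAlgebra.mapDomain_single]
        rfl)
    obtain ⟨Q, hQ, hQB, hQS, hQcls⟩ := Splits.prod (prodComplex C n) ρ' hρ
      (hgap (MonoidHom.inl _ _) (MonoidHom.fst _ _) fun w => rfl) hP hPB hPS
    exact ⟨Q, hQ, hQB, hQS, hQcls.trans hcls⟩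

end

/-! ### The spectral gap of the free group -/

section

theorem hasInvSqrt_of_spectrum_pos {B : Type*} [CStarAlgebra B] {t : B} (ht : IsSelfAdjoint t)
    (h : ∀ x ∈ spectrum ℝ t, 0 < x) : HasInvSqrt t := by
  have hcont : ContinuousOn (fun x : ℝ => (Real.sqrt x)⁻¹) (spectrum ℝ t) :=
    Real.continuous_sqrt.continuousOn.inv₀ fun x hx => (Real.sqrt_pos.2 (h x hx)).ne'
  refine ⟨cfc (fun x : ℝ => (Real.sqrt x)⁻¹) t, ?_, ?_, ?_⟩
  · exact cfc_predicate (p := IsSelfAdjoint) (fun x : ℝ => (Real.sqrt x)⁻¹) t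
  · rw [mem_bicommutant]
    intro c hc
    exact (Commute.cfc_real (hc t rfl).symm _).symm
  · conv_lhs => rhs; rw [← cfc_id' ℝ t]
    rw [← cfc_mul _ _ t hcont hcont, 
      ← cfc_mul (fun x : ℝ => (Real.sqrt x)⁻¹ * (Real.sqrt x)⁻¹) (fun x => x) t (hcont.mul hcont)
        (continuousOn_id' _), ← cfc_one ℝ t]
    refine cfc_congr fun x hx => ?_
    have h1 := h x hx
    have h3 := (Real.sqrt_pos.2 h1).ne'
    simp only [Pi.one_apply]
    field_simp
    rw [Real.sq_sqrt h1.le]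

theorem hasSum_norm_sq {G : Type*} (f : L2 G) : HasSum (fun g => ‖f g‖ ^ 2) (‖f‖ ^ 2) := by
  simpa using lp.hasSum_norm (p := 2) (by norm_num) f

variable {G : Type*} [Group G]

open Classical in
/-- The spectral gap of the free group, quantitatively: if `F₂` is a retract of `G`, then the
Laplacian of `F₂` is bounded below by `1/6` on `ℓ²(G)`. Let `W` be the set of reduced words that
start with `x`, and `W'` of those that start with `x⁻¹`. As `W ∪ x W'` is everything, the mass of
`f` on `W` and that of `λ(x⁻¹) f` on `W'` add up to at least `‖f‖²`. Summing over both generators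
gives `2 ‖f‖²`, whereas the four sets `W`, `W'` are disjoint. -/
theorem norm_sq_le_sum_translate (i : FreeGroup (Fin 2) →* G) (r : G →* FreeGroup (Fin 2))
    (hr : ∀ w, r (i w) = w) (f : L2 G) :
    ‖f‖ ^ 2 ≤ 6 * ∑ k, ‖leftRegular G (i (FreeGroup.of k)) f - f‖ ^ 2 := by
  have hf := hasSum_norm_sq f
  have hE : ∀ k, HasSum (fun g => ‖f g - f (i (FreeGroup.of k) * g)‖ ^ 2)
      (‖leftRegular G (i (FreeGroup.of k)) f - f‖ ^ 2) := by
    intro k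
    have h1 := hasSum_norm_sq (leftRegular G (i (FreeGroup.of k)) f - f)
    rw [← (Equiv.mulLeft (i (FreeGroup.of k))).hasSum_iff] at h1
    refine h1.congr_fun fun g => ?_
    change _ = ‖f ((i (FreeGroup.of k))⁻¹ * (i (FreeGroup.of k) * g)) -
      f (i (FreeGroup.of k) * g)‖ ^ 2
    rw [inv_mul_cancel_left]
  let χ : Fin 2 × Bool → G → ℝ := fun w g => if r g ∈ FreeGroup.startsWith w then 1 else 0
  have hχ0 : ∀ w g, 0 ≤ χ w g := fun w g => by
    simp only [χ]
    split_ifs <;> norm_num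
  have hχ1 : ∀ w g, χ w g ≤ 1 := fun w g => by
    simp only [χ]
    split_ifs <;> norm_num
  have hχ : ∀ g, ∑ w, χ w g ≤ 1 := by
    intro g
    rcases h : (r g).toWord[0]? with _ | w
    · simp [χ, FreeGroup.startsWith, h]
    · simp [χ, FreeGroup.startsWith, h]
  have hsum : ∀ w, Summable fun g => χ w g * ‖f g‖ ^ 2 := fun w =>
    Summable.of_nonneg_of_le (fun g => mul_nonneg (hχ0 w g) (sq_nonneg _))
      (fun g => mul_le_of_le_one_left (sq_nonneg _) (hχ1 w g)) hf.summable
  have htotal : ∑ w, ∑' g, χ w g * ‖f g‖ ^ 2 ≤ ‖f‖ ^ 2 := by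
    rw [← Summable.tsum_finsetSum fun w _ => hsum w, ← hf.tsum_eq]
    refine Summable.tsum_le_tsum (fun g => ?_) (summable_sum fun w _ => hsum w) hf.summable
    rw [← Finset.sum_mul]
    exact mul_le_of_le_one_left (sq_nonneg _) (hχ g)
  have hk : ∀ k, ‖f‖ ^ 2 ≤ (4 / 3) * (∑ b, ∑' g, χ (k, b) g * ‖f g‖ ^ 2) +
      4 * ‖leftRegular G (i (FreeGroup.of k)) f - f‖ ^ 2 := by
    intro k
    set x := i (FreeGroup.of k) with hx
    have hcover : ∀ g, 1 ≤ χ (k, true) (x * g) + χ (k, false) g := by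
      intro g
      by_cases h : r g ∈ FreeGroup.startsWith (k, false)
      · have : χ (k, false) g = 1 := if_pos h
        linarith [hχ0 (k, true) (x * g)]
      · have h1 := FreeGroup.startsWith_mk_mul (w := (k, true)) (r g) h
        have : χ (k, true) (x * g) = 1 := if_pos (by rw [map_mul, hx, hr]; exact h1)
        linarith [hχ0 (k, false) g]
    have hpt : ∀ g, ‖f (x * g)‖ ^ 2 ≤ χ (k, true) (x * g) * ‖f (x * g)‖ ^ 2 +
        ((4 / 3) * (χ (k, false) g * ‖f g‖ ^ 2) + 4 * ‖f g - f (x * g)‖ ^ 2) := by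
      intro g
      have h1 : ‖f (x * g)‖ ≤ ‖f g‖ + ‖f g - f (x * g)‖ := by
        have := norm_sub_norm_le (f (x * g)) (f g)
        rw [norm_sub_rev (f (x * g))] at this
        linarith
      -- As `(u + v)² ≤ (4/3) u² + 4 v²`, summing over both generators gives `2 S ≤ (4/3) S + 4 E`
      -- for `S = ‖f‖²`, whence the constant `6`.
      have h2 : ‖f (x * g)‖ ^ 2 ≤ (4 / 3) * ‖f g‖ ^ 2 + 4 * ‖f g - f (x * g)‖ ^ 2 := by
        have := pow_le_pow_left₀ (norm_nonneg _) h1 2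
        nlinarith [sq_nonneg (‖f g‖ - 3 * ‖f g - f (x * g)‖)]
      have h3 := mul_le_mul_of_nonneg_left h2 (hχ0 (k, false) g)
      have h4 := mul_le_mul_of_nonneg_right (hcover g) (sq_nonneg ‖f (x * g)‖)
      have h5 := mul_le_mul_of_nonneg_right (hχ1 (k, false) g) (sq_nonneg ‖f g - f (x * g)‖)
      linarith
    have hL := (Equiv.mulLeft x).hasSum_iff.2 hf
    have hR1 := (Equiv.mulLeft x).hasSum_iff.2 (hsum (k, true)).hasSum
    have hR2 := ((hsum (k, false)).hasSum.mul_left (4 / 3)).add ((hE k).mul_left 4)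
    have hle := hasSum_le hpt hL (hR1.add hR2)
    have hnn : 0 ≤ ∑' g, χ (k, true) g * ‖f g‖ ^ 2 :=
      tsum_nonneg fun g => mul_nonneg (hχ0 _ g) (sq_nonneg _)
    rw [Fintype.sum_bool]
    linarith
  have h := add_le_add (hk 0) (hk 1)
  rw [Fintype.sum_prod_type, Fin.sum_univ_two] at htotal
  rw [Fin.sum_univ_two]
  linarith

theorem isClosed_cstarRed : IsClosed ((CStarRed G : StarSubalgebra ℂ (L2 G →L[ℂ] L2 G)) :
    Set (L2 G →L[ℂ] L2 G)) :=
  StarSubalgebra.isClosed_topologicalClosure _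

open BasedComplex in
/-- The Laplacian in degree `0` of a retract of `G` isomorphic to `F₂` has an inverse square root
in `C*_red(G)`. -/
theorem hasInvSqrt_freeCob (i : FreeGroup (Fin 2) →* G) (r : G →* FreeGroup (Fin 2))
    (hr : ∀ w, r (i w) = w) :
    HasInvSqrt (((freeCob ((ofGroupRing G).comp (MonoidAlgebra.mapDomainRingHom ℤ i)))ᴴ *
      freeCob ((ofGroupRing G).comp (MonoidAlgebra.mapDomainRingHom ℤ i))) () ()) := by
  set ρ := (ofGroupRing G).comp (MonoidAlgebra.mapDomainRingHom ℤ i) with hρ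
  have hentry : ∀ k, freeCob ρ k () = unitaryOf G (i (FreeGroup.of k)) - 1 := by
    intro k
    rw [freeCob, of_apply, map_sub, map_one]
    simp [hρ, ofGroupRing, MonoidAlgebra.of_apply]
  set t := ((freeCob ρ)ᴴ * freeCob ρ) () () with ht
  have htsum : t = ∑ k, star (unitaryOf G (i (FreeGroup.of k)) - 1) *
      (unitaryOf G (i (FreeGroup.of k)) - 1) := by
    simp only [ht, mul_apply, conjTranspose_apply, hentry]
  have hts : IsSelfAdjoint t := by
    rw [htsum]
    exact isSelfAdjoint_sum _ fun k _ => IsSelfAdjoint.star_mul_self _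
  have hinner : ∀ f : L2 G, inner ℂ ((t : L2 G →L[ℂ] L2 G) f) f =
      ((∑ k, ‖leftRegular G (i (FreeGroup.of k)) f - f‖ ^ 2 : ℝ) : ℂ) := by
    intro f
    have : (t : L2 G →L[ℂ] L2 G) = ∑ k, star (leftRegular G (i (FreeGroup.of k)) - 1) *
        (leftRegular G (i (FreeGroup.of k)) - 1) := by
      rw [htsum]
      simp [unitaryOf]
    rw [this, _root_.sum_apply, sum_inner]
    rw [Complex.ofReal_sum]
    refine Finset.sum_congr rfl fun k _ => ?_
    rw [ContinuousLinearMap.star_eq_adjoint, mul_apply_eq_comp,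
      ContinuousLinearMap.adjoint_inner_left, inner_self_eq_norm_sq_to_K, Complex.ofReal_pow]
    rfl
  have := isClosed_cstarRed (G := G)
  refine hasInvSqrt_of_spectrum_pos hts fun x hx => ?_
  by_contra! hx0
  refine hx ?_
  rw [spectrum.mem_resolventSet_iff, ← IsUnit.neg_iff, neg_sub, ← (CStarRed G).coe_isUnit]
  refine ContinuousLinearMap.isUnit_of_forall_le_norm_inner_map _ (c := 1 / 6) (by norm_num)
    fun f => ?_
  have h1 : inner ℂ (((t - algebraMap ℝ (CStarRed G) x : CStarRed G) : L2 G →L[ℂ] L2 G) f) f =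
      ((∑ k, ‖leftRegular G (i (FreeGroup.of k)) f - f‖ ^ 2 - x * ‖f‖ ^ 2 : ℝ) : ℂ) := by
    have : (((t - algebraMap ℝ (CStarRed G) x : CStarRed G) : L2 G →L[ℂ] L2 G) f) =
      (t : L2 G →L[ℂ] L2 G) f - (x : ℂ) • f := rfl
    rw [this, inner_sub_left, hinner, inner_smul_left, inner_self_eq_norm_sq_to_K]
    push_cast
    simp
  have h2 := norm_sq_le_sum_translate i r hr f
  refine le_trans ?_ ((Complex.re_le_norm _).trans_eq (by rw [h1]))
  rw [Complex.ofReal_re]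
  push_cast
  nlinarith [sq_nonneg ‖f‖]

end

/-! ### Laplacians as operators -/

section

variable {G : Type*} [Group G]

section MatOp

variable {ι κ μ : Type*} [Fintype ι] [Fintype κ] [Fintype μ]

theorem matOp_mul (M : Matrix ι κ (CStarRed G)) (N : Matrix κ μ (CStarRed G)) :
    matOp (M * N) = matOp M ∘L matOp N := by
  refine ContinuousLinearMap.ext fun x => PiLp.ext fun i => ?_
  rw [ContinuousLinearMap.comp_apply, matOp_apply, matOp_apply]
  simp only [matOp_apply, map_sum]
  rw [Finset.sum_comm]
  refine Finset.sum_congr rfl fun k _ => ?_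
  rw [mul_apply, AddSubmonoidClass.coe_finsetSum, _root_.sum_apply]
  rfl

theorem matOp_add (M N : Matrix ι κ (CStarRed G)) : matOp (M + N) = matOp M + matOp N := by
  refine ContinuousLinearMap.ext fun x => PiLp.ext fun i => ?_
  rw [_root_.add_apply, PiLp.add_apply, matOp_apply, matOp_apply, matOp_apply,
    ← Finset.sum_add_distrib]
  rfl

theorem matOp_zero : matOp (0 : Matrix ι κ (CStarRed G)) = 0 := by
  refine ContinuousLinearMap.ext fun x => PiLp.ext fun i => ?_
  rw [matOp_apply]
  exact Finset.sum_eq_zero fun k _ => rfl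

theorem matOp_one [DecidableEq ι] : matOp (1 : Matrix ι ι (CStarRed G)) = 1 := by
  refine ContinuousLinearMap.ext fun x => PiLp.ext fun i => ?_
  rw [matOp_apply, Finset.sum_eq_single i]
  · rw [one_apply_eq]
    rfl
  · intro k _ hk
    rw [one_apply_ne' hk]
    rfl
  · simp

theorem inner_matOp_conjTranspose (M : Matrix ι κ (CStarRed G)) (x : PiLp 2 fun _ : κ => L2 G)
    (y : PiLp 2 fun _ : ι => L2 G) :
    inner ℂ (matOp Mᴴ y) x = inner ℂ y (matOp M x) := by
  simp only [PiLp.inner_apply, matOp_apply, sum_inner, inner_sum]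
  rw [Finset.sum_comm]
  refine Finset.sum_congr rfl fun i _ => Finset.sum_congr rfl fun k _ => ?_
  rw [conjTranspose_apply]
  change inner ℂ ((star (M i k : L2 G →L[ℂ] L2 G)) (y i)) (x k) = _
  rw [ContinuousLinearMap.star_eq_adjoint, ContinuousLinearMap.adjoint_inner_left]

end MatOp

/-- Moving the eigenvalue of `S` on the range of a spectral projection `p` from `1 - z` to `-z`
preserves invertibility, if `z ≠ 0`. -/
theorem isUnit_sub_of_isIdempotentElem {B : Type*} [Ring B] [Algebra ℂ B] {S p : B} {z : ℂ}
    (hz : z ≠ 0) (hS : IsUnit S) (hp : p * p = p) (h1 : S * p = (1 - z) • p)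
    (h2 : p * S = (1 - z) • p) : IsUnit (S - p) := by
  obtain ⟨u, rfl⟩ := hS
  have hc : (↑u⁻¹ : B) * p = p * ↑u⁻¹ := by
    have : Commute (u : B) p := h1.trans h2.symm
    exact this.units_inv_left
  have h3 : ∀ w : B, z⁻¹ • w - z⁻¹ • (1 - z) • w = w := fun w => by
    rw [smul_smul, ← sub_smul]
    convert one_smul ℂ w
    field_simp
    ring
  refine isUnit_iff_exists.2 ⟨↑u⁻¹ * (1 - p) - z⁻¹ • p, ?_, ?_⟩
  · have h4 : p * (↑u⁻¹ * (1 - p)) = 0 := by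
      rw [← mul_assoc, ← hc, mul_assoc, mul_sub, hp, mul_one, sub_self, mul_zero]
    rw [mul_sub, sub_mul, sub_mul, h4, Units.mul_inv_cancel_left, mul_smul_comm, mul_smul_comm, h1,
      hp]
    rw [show 1 - p - 0 - (z⁻¹ • (1 - z) • p - z⁻¹ • p) =
      1 - p + (z⁻¹ • p - z⁻¹ • (1 - z) • p) by abel, h3, sub_add_cancel]
  · have h4 : ↑u⁻¹ * (1 - p) * p = 0 := by
      rw [mul_assoc, sub_mul, hp, one_mul, sub_self, mul_zero]
    have h5 : ↑u⁻¹ * (1 - p) * ↑u = 1 - p := by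
      rw [mul_sub, mul_one, sub_mul, Units.inv_mul, hc, mul_assoc, Units.inv_mul, mul_one]
    rw [sub_mul, mul_sub (↑u⁻¹ * (1 - p)), mul_sub (z⁻¹ • p), h4, h5, smul_mul_assoc,
      smul_mul_assoc, h2, hp]
    rw [show 1 - p - 0 - (z⁻¹ • (1 - z) • p - z⁻¹ • p) =
      1 - p + (z⁻¹ • p - z⁻¹ • (1 - z) • p) by abel, h3, sub_add_cancel]

namespace BasedComplex

variable (C : BasedComplex G) (i : ℕ)

theorem laplacian_eq : C.laplacian i =
    (C.cob (ofGroupRing G) i)ᴴ * C.cob (ofGroupRing G) i +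
      C.cobPrev (ofGroupRing G) i * (C.cobPrev (ofGroupRing G) i)ᴴ := by
  cases i with
  | zero =>
    have : C.cobPrev (ofGroupRing G) 0 * (C.cobPrev (ofGroupRing G) 0)ᴴ = 0 := by
      have : IsEmpty (C.PrevCells 0) := ⟨fun x => Nat.succ_ne_zero _ x.2⟩
      ext1 x y
      rw [mul_apply]
      exact Fintype.sum_empty _
    rw [this, add_zero]
    rfl
  | succ i =>
    change _ + _ = _ + _
    congr 1
    let e : C.PrevCells (i + 1) ≃ C.Cells i :=
      Equiv.subtypeEquivRight fun c => Nat.succ_inj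
    ext1 x y
    rw [mul_apply, mul_apply]
    exact (e.sum_comp fun z => C.d i x z * (C.d i)ᴴ z y).symm

variable {C i} {P : Matrix (C.Cells i) (C.Cells i) (CStarRed G)}

theorem Splits.laplacian_mul (hP : IsStarProjection P) (h : C.Splits (ofGroupRing G) i P) :
    C.laplacian i * P = 0 := by
  have hP' := isStarProjection_iff.1 hP
  have h1 : (C.cobPrev (ofGroupRing G) i)ᴴ * P = 0 := by
    rw [← hP'.2, ← conjTranspose_mul, h.2.1, conjTranspose_zero]
  rw [laplacian_eq, Matrix.add_mul, Matrix.mul_assoc, Matrix.mul_assoc, h.1, h1, Matrix.mul_zero,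
    Matrix.mul_zero, add_zero]

/-- If `P` splits off the cohomology in degree `i`, then `Δ + P` is bounded below. In fact
`‖x‖² = ‖P x‖² + ⟨d* x, h x⟩ + ⟨h'* x, d x⟩` for the null-homotopy `(h, h')` of `1 - P`, while
`⟨(Δ + P) x, x⟩ = ‖P x‖² + ‖d* x‖² + ‖d x‖²`. -/
theorem Splits.exists_le_inner (hP : IsStarProjection P) (h : C.Splits (ofGroupRing G) i P) :
    ∃ c : ℝ, 0 < c ∧ ∀ x : C.Cochain i,
      c * ‖x‖ ^ 2 ≤ (inner ℂ (matOp (C.laplacian i + P) x) x).re := by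
  classical
  have hP' := isStarProjection_iff.1 hP
  obtain ⟨-, -, k, k', -, -, hk⟩ := h
  set D := C.cob (ofGroupRing G) i with hD
  set D' := C.cobPrev (ofGroupRing G) i with hD'
  set K := max 1 (max ‖matOp k‖ ‖matOp k'ᴴ‖) with hK
  have hK1 : 1 ≤ K := le_max_left _ _
  have hinner : ∀ x : C.Cochain i, (inner ℂ (matOp (C.laplacian i + P) x) x).re =
      ‖matOp D x‖ ^ 2 + ‖matOp D'ᴴ x‖ ^ 2 + ‖matOp P x‖ ^ 2 := by
    intro x
    have e1 : inner ℂ (matOp (Dᴴ * D) x) x = inner ℂ (matOp D x) (matOp D x) := by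
      rw [matOp_mul, ContinuousLinearMap.comp_apply, inner_matOp_conjTranspose]
    have e2 : inner ℂ (matOp (D' * D'ᴴ) x) x = inner ℂ (matOp D'ᴴ x) (matOp D'ᴴ x) := by
      have := inner_matOp_conjTranspose D'ᴴ x (matOp D'ᴴ x)
      rw [conjTranspose_conjTranspose] at this
      rw [matOp_mul, ContinuousLinearMap.comp_apply, this]
    have e3 : inner ℂ (matOp P x) x = inner ℂ (matOp P x) (matOp P x) := by
      have := inner_matOp_conjTranspose P x (matOp P x)
      rw [← this, hP'.2, ← ContinuousLinearMap.comp_apply, ← matOp_mul, hP'.1]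
    rw [laplacian_eq, matOp_add, matOp_add, _root_.add_apply, _root_.add_apply, inner_add_left,
      inner_add_left, e1, e2, e3]
    simp only [inner_self_eq_norm_sq_to_K, Complex.add_re]
    norm_cast
  refine ⟨(3 * K ^ 2)⁻¹, by positivity, fun x => ?_⟩
  rw [hinner]
  have hx : x = matOp P x + (matOp D' (matOp k x) + matOp k' (matOp D x)) := by
    have h1 : matOp (P + (D' * k + k' * D)) x = x := by
      rw [hk, add_sub_cancel, matOp_one]
      rfl
    rw [matOp_add, matOp_add, matOp_mul, matOp_mul] at h1
    exact h1.symm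
  have hb1 : ‖inner ℂ x (matOp P x)‖ ≤ ‖x‖ * (K * ‖matOp P x‖) :=
    (norm_inner_le_norm _ _).trans (mul_le_mul_of_nonneg_left
      (le_mul_of_one_le_left (norm_nonneg _) hK1) (norm_nonneg _))
  have hb2 : ‖inner ℂ x (matOp D' (matOp k x))‖ ≤ ‖x‖ * (K * ‖matOp D'ᴴ x‖) := by
    rw [← inner_matOp_conjTranspose]
    refine (norm_inner_le_norm _ _).trans ?_
    have h1 : ‖matOp k x‖ ≤ K * ‖x‖ := (ContinuousLinearMap.le_opNorm _ _).trans
      (mul_le_mul_of_nonneg_right ((le_max_left _ _).trans (le_max_right _ _)) (norm_nonneg _))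
    calc _ ≤ ‖matOp D'ᴴ x‖ * (K * ‖x‖) := mul_le_mul_of_nonneg_left h1 (norm_nonneg _)
      _ = _ := by ring
  have hb3 : ‖inner ℂ x (matOp k' (matOp D x))‖ ≤ ‖x‖ * (K * ‖matOp D x‖) := by
    rw [← inner_matOp_conjTranspose]
    refine (norm_inner_le_norm _ _).trans ?_
    have h1 : ‖matOp k'ᴴ x‖ ≤ K * ‖x‖ := (ContinuousLinearMap.le_opNorm _ _).trans
      (mul_le_mul_of_nonneg_right ((le_max_right _ _).trans (le_max_right _ _)) (norm_nonneg _))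
    calc _ ≤ K * ‖x‖ * ‖matOp D x‖ := mul_le_mul_of_nonneg_right h1 (norm_nonneg _)
      _ = _ := by ring
  have hsq : ‖x‖ * ‖x‖ ≤ ‖x‖ * (K * (‖matOp P x‖ + ‖matOp D'ᴴ x‖ + ‖matOp D x‖)) := by
    have h1 : ‖inner ℂ x x‖ = ‖x‖ * ‖x‖ := by
      rw [inner_self_eq_norm_sq_to_K, ← sq]
      simp
    have h2 : inner ℂ x x = inner ℂ x (matOp P x) +
        (inner ℂ x (matOp D' (matOp k x)) + inner ℂ x (matOp k' (matOp D x))) := by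
      rw [← inner_add_right, ← inner_add_right, ← hx]
    rw [← h1, h2]
    refine (norm_add_le _ _).trans ?_
    have h3 := norm_add_le (inner ℂ x (matOp D' (matOp k x))) (inner ℂ x (matOp k' (matOp D x)))
    linarith
  have hle : ‖x‖ ≤ K * (‖matOp P x‖ + ‖matOp D'ᴴ x‖ + ‖matOp D x‖) := by
    rcases (norm_nonneg x).eq_or_lt with h0 | h0
    · rw [← h0]
      positivity
    · exact le_of_mul_le_mul_left hsq h0
  rw [inv_mul_le_iff₀ (by positivity)]
  calc ‖x‖ ^ 2 ≤ (K * (‖matOp P x‖ + ‖matOp D'ᴴ x‖ + ‖matOp D x‖)) ^ 2 :=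
        pow_le_pow_left₀ (norm_nonneg _) hle 2
    _ = K ^ 2 * (‖matOp P x‖ + ‖matOp D'ᴴ x‖ + ‖matOp D x‖) ^ 2 := by ring
    _ ≤ K ^ 2 * (3 * (‖matOp D x‖ ^ 2 + ‖matOp D'ᴴ x‖ ^ 2 + ‖matOp P x‖ ^ 2)) := by
        refine mul_le_mul_of_nonneg_left ?_ (sq_nonneg _)
        nlinarith [sq_nonneg (‖matOp P x‖ - ‖matOp D'ᴴ x‖),
          sq_nonneg (‖matOp P x‖ - ‖matOp D x‖), sq_nonneg (‖matOp D'ᴴ x‖ - ‖matOp D x‖)]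
    _ = _ := by ring

theorem Splits.isUnit_sub (hP : IsStarProjection P) (h : C.Splits (ofGroupRing G) i P) :
    ∃ c : ℝ, 0 < c ∧ ∀ z : ℂ, ‖z‖ < c →
      IsUnit (matOp (C.laplacian i + P) - algebraMap ℂ (C.Cochain i →L[ℂ] C.Cochain i) z) := by
  obtain ⟨c, hc, hle⟩ := h.exists_le_inner hP
  refine ⟨c, hc, fun z hz => ?_⟩
  refine ContinuousLinearMap.isUnit_of_forall_le_norm_inner_map _ (c := ⟨c - ‖z‖, by linarith⟩)
    (by exact sub_pos.2 hz) fun x => ?_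
  have h1 : (matOp (C.laplacian i + P) - algebraMap ℂ (C.Cochain i →L[ℂ] C.Cochain i) z) x =
      matOp (C.laplacian i + P) x - z • x := rfl
  have h2 : ‖inner ℂ (z • x) x‖ = ‖z‖ * ‖x‖ ^ 2 := by
    rw [inner_smul_left, norm_mul, inner_self_eq_norm_sq_to_K]
    simp
  rw [h1, inner_sub_left]
  have h3 := norm_sub_norm_le (inner ℂ (matOp (C.laplacian i + P) x) x) (inner ℂ (z • x) x)
  have h4 := (hle x).trans (Complex.re_le_norm _)
  change ‖x‖ ^ 2 * (c - ‖z‖) ≤ _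
  rw [h2] at h3
  linarith

theorem Splits.hasSpectralGap (hP : IsStarProjection P) (h : C.Splits (ofGroupRing G) i P) :
    HasSpectralGap (C.laplacianOp i) := by
  obtain ⟨c, hc, hu⟩ := h.isUnit_sub hP
  have hP' := isStarProjection_iff.1 hP
  refine ⟨c, hc, fun z hz => ?_⟩
  by_contra! hz'
  refine hz ?_
  have hpp : matOp P * matOp P = matOp P := by
    rw [ContinuousLinearMap.mul_def, ← matOp_mul, hP'.1]
  have hLs : (C.laplacian i)ᴴ = C.laplacian i := by
    simp [laplacian_eq]
  have hPL : P * C.laplacian i = 0 := by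
    have := congrArg conjTranspose (h.laplacian_mul hP)
    rwa [conjTranspose_mul, hP'.2, hLs, conjTranspose_zero] at this
  have h1 := isUnit_sub_of_isIdempotentElem hz'.1 (hu z hz'.2) hpp
    (by rw [sub_mul, ContinuousLinearMap.mul_def, ← matOp_mul, Matrix.add_mul, h.laplacian_mul hP,
      hP'.1, zero_add, Algebra.algebraMap_eq_smul_one, smul_mul_assoc, one_mul, sub_smul, one_smul])
    (by rw [mul_sub, ContinuousLinearMap.mul_def, ← matOp_mul, Matrix.mul_add, hPL,
      hP'.1, zero_add, Algebra.algebraMap_eq_smul_one, mul_smul_comm, mul_one, sub_smul, one_smul])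
  rw [spectrum.mem_resolventSet_iff, ← IsUnit.neg_iff]
  convert h1 using 1
  rw [matOp_add, laplacianOp]
  abel

theorem Splits.matOp_eq_kazhdanProjection (hP : IsStarProjection P)
    (h : C.Splits (ofGroupRing G) i P) : matOp P = C.kazhdanProjection i := by
  obtain ⟨c, hc, hu⟩ := h.isUnit_sub hP
  have hP' := isStarProjection_iff.1 hP
  have hu0 := hu 0 (by simpa using hc)
  rw [map_zero, sub_zero, ContinuousLinearMap.isUnit_iff_bijective] at hu0
  have hLP : ∀ x, matOp (C.laplacian i) (matOp P x) = 0 := by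
    intro x
    rw [← ContinuousLinearMap.comp_apply, ← matOp_mul, h.laplacian_mul hP, matOp_zero]
    rfl
  have hPP : ∀ x, matOp P (matOp P x) = matOp P x := by
    intro x
    rw [← ContinuousLinearMap.comp_apply, ← matOp_mul, hP'.1]
  have hker : ∀ x, matOp (C.laplacian i) x = 0 → matOp P x = x := by
    intro x hx
    refine (hu0.1 ?_)
    rw [matOp_add, _root_.add_apply, _root_.add_apply, hLP, hPP, hx]
  unfold kazhdanProjection
  refine ContinuousLinearMap.ext fun x => (Submodule.eq_starProjection_of_mem_of_inner_eq_zero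
    (hLP x) fun w hw => ?_).symm
  have hw' : matOp P w = w := hker w hw
  rw [← hw', ← inner_matOp_conjTranspose, hP'.2, map_sub, hPP, sub_self, inner_zero_left]

end BasedComplex

end

/-! ### The canonical trace on K-theory -/

section

section Trace

variable {A : Type*} [Ring A] [StarRing A] {M : Type*} [AddCommGroup M] (τ : A →+ M)

theorem sum_diag_eq_of_mvN (hτ : ∀ a b, τ (a * b) = τ (b * a))
    {ι κ : Type*} [Fintype ι] [Fintype κ] {p : Matrix ι ι A}
    {q : Matrix κ κ A} (h : MvN p q) : ∑ i, τ (p i i) = ∑ k, τ (q k k) := by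
  obtain ⟨v, rfl, rfl⟩ := h
  simp only [mul_apply, map_sum]
  rw [Finset.sum_comm]
  exact Finset.sum_congr rfl fun k _ => Finset.sum_congr rfl fun i _ => hτ _ _

theorem sum_diag_ofMatrix {ι : Type*} [Fintype ι] (p : Matrix ι ι A) (hp : IsStarProjection p) :
    ∑ i, τ ((MatProj.ofMatrix p hp).2.1 i i) = ∑ i, τ (p i i) :=
  (Fintype.equivFin ι).symm.sum_comp fun i => τ (p i i)

variable (hτ : ∀ a b, τ (a * b) = τ (b * a))

/-- The homomorphism `K₀(A) → M` induced by a trace `τ : A → M`, that is, `[p] ↦ ∑ᵢ τ(pᵢᵢ)`. -/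
def K0.trace : K0 A →+ M :=
  Algebra.GrothendieckAddGroup.lift
    { toFun := Quotient.lift (fun p : MatProj A => ∑ i, τ (p.2.1 i i))
        fun _ _ h => sum_diag_eq_of_mvN τ hτ h
      map_zero' := (sum_diag_ofMatrix τ _ _).trans (Fintype.sum_empty _)
      map_add' := by
        intro x y
        obtain ⟨m, p, hp, rfl⟩ := V.exists_mk x
        obtain ⟨n, q, hq, rfl⟩ := V.exists_mk y
        rw [V.mk_add_mk]
        refine (sum_diag_ofMatrix τ _ _).trans ((Fintype.sum_sum_type _).trans ?_)
        exact congrArg₂ (· + ·) (sum_diag_ofMatrix τ p hp).symm (sum_diag_ofMatrix τ q hq).symm }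

theorem K0.trace_cls {ι : Type*} [Fintype ι] (p : Matrix ι ι A) (hp : IsStarProjection p) :
    K0.trace τ hτ (K0.cls p hp) = ∑ i, τ (p i i) := by
  unfold K0.trace K0.cls
  refine (DFunLike.congr_fun (Algebra.GrothendieckAddGroup.lift.symm_apply_apply _) _).trans ?_
  exact sum_diag_ofMatrix τ p hp

end Trace

variable {G : Type*} [Group G]

/-- A continuous functional that vanishes on all `λ(g)` vanishes on `C*_red(G)`, since the `λ(g)`
span a dense subspace. -/
theorem eq_zero_of_leftRegular (φ : (L2 G →L[ℂ] L2 G) →L[ℂ] ℂ) (h : ∀ g, φ (leftRegular G g) = 0)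
    (T : CStarRed G) : φ T = 0 := by
  have hcl : IsClosed {T : L2 G →L[ℂ] L2 G | φ T = 0} := isClosed_eq φ.continuous continuous_const
  have hle : (StarAlgebra.adjoin ℂ (Set.range (leftRegular G)) : Set (L2 G →L[ℂ] L2 G)) ⊆
      {T : L2 G →L[ℂ] L2 G | φ T = 0} := by
    intro S hS
    have hstar : Set.range (leftRegular G) ∪ star (Set.range (leftRegular G)) =
        (MonoidHom.mrange (leftRegular G) : Set (L2 G →L[ℂ] L2 G)) := by
      refine Set.Subset.antisymm (Set.union_subset subset_rfl ?_) Set.subset_union_left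
      rintro S ⟨g, hg⟩
      exact ⟨g⁻¹, by rw [← star_leftRegular, hg, star_star]⟩
    have hS' : S ∈ Submodule.span ℂ (Set.range (leftRegular G)) := by
      have h1 := StarAlgebra.adjoin_eq_span (R := ℂ) (Set.range (leftRegular G))
      rw [hstar, Submonoid.closure_eq] at h1
      have h2 : S ∈ Subalgebra.toSubmodule
        (StarAlgebra.adjoin ℂ (Set.range (leftRegular G))).toSubalgebra := hS
      rw [h1] at h2
      exact h2
    refine Submodule.span_induction (p := fun S _ => φ S = 0) ?_ (map_zero φ) ?_ ?_ hS'
    · rintro _ ⟨g, rfl⟩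
      exact h g
    · intro x y _ _ hx hy
      rw [map_add, hx, hy, add_zero]
    · intro c x _ hx
      rw [map_smul, hx, smul_zero]
  exact closure_minimal hle hcl T.2

open Classical in
/-- The vector state `T ↦ ⟨δ₁, T δ₁⟩` of `B(ℓ²(G))`. -/
def vectorState : (L2 G →L[ℂ] L2 G) →L[ℂ] ℂ :=
  (innerSL ℂ (lp.single 2 (1 : G) (1 : ℂ))).comp
    (ContinuousLinearMap.apply ℂ (L2 G) (lp.single 2 (1 : G) (1 : ℂ)))

open Classical in
theorem vectorState_leftRegular (g : G) :
    vectorState (leftRegular G g) = if g = 1 then 1 else 0 := by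
  change inner ℂ (lp.single 2 (1 : G) (1 : ℂ)) (leftRegular G g (lp.single 2 (1 : G) (1 : ℂ))) = _
  rw [lp.inner_single_left]
  change inner ℂ 1 ((lp.single 2 (1 : G) (1 : ℂ) : L2 G) (g⁻¹ * 1)) = _
  by_cases h : g = 1
  · simp [h]
  · simp [h]

/-- The vector state at `δ₁` restricts to a trace on `C*_red(G)`. -/
theorem vectorState_mul_comm (S T : CStarRed G) :
    vectorState ((S * T : CStarRed G) : L2 G →L[ℂ] L2 G) =
      vectorState ((T * S : CStarRed G) : L2 G →L[ℂ] L2 G) := by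
  classical
  -- The functional `X ↦ τ(X R) - τ(R X)`.
  let φ : (L2 G →L[ℂ] L2 G) → (L2 G →L[ℂ] L2 G) →L[ℂ] ℂ := fun R => vectorState.comp
    ((ContinuousLinearMap.mul ℂ (L2 G →L[ℂ] L2 G)).flip R -
      ContinuousLinearMap.mul ℂ (L2 G →L[ℂ] L2 G) R)
  have hφ : ∀ R X, φ R X = vectorState (X * R) - vectorState (R * X) :=
    fun R X => map_sub vectorState (X * R) (R * X)
  have h1 : ∀ (g : G) (X : CStarRed G), φ (leftRegular G g) X = 0 := by
    intro g X
    refine eq_zero_of_leftRegular _ (fun k => ?_) X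
    rw [hφ, ← map_mul, ← map_mul, vectorState_leftRegular, vectorState_leftRegular, sub_eq_zero]
    simp only [mul_eq_one_iff_eq_inv, eq_comm (a := g), inv_eq_iff_eq_inv]
  have h2 : φ (S : L2 G →L[ℂ] L2 G) T = 0 := by
    refine eq_zero_of_leftRegular _ (fun g => ?_) T
    have h3 := h1 g S
    rw [hφ, sub_eq_zero] at h3 ⊢
    exact h3.symm
  rw [hφ, sub_eq_zero] at h2
  exact h2.symm

variable (G) in
/-- The canonical trace on `C*_red(G)`. -/
def canonicalTrace : CStarRed G →+ ℂ :=
  (vectorState : (L2 G →L[ℂ] L2 G) →L[ℂ] ℂ).toLinearMap.toAddMonoidHom.comp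
    (CStarRed G).subtype.toAlgHom.toLinearMap.toAddMonoidHom

theorem canonicalTrace_mul_comm (S T : CStarRed G) :
    canonicalTrace G (S * T) = canonicalTrace G (T * S) :=
  vectorState_mul_comm S T

theorem canonicalTrace_one : canonicalTrace G 1 = 1 := by
  change vectorState (1 : L2 G →L[ℂ] L2 G) = 1
  rw [← map_one (leftRegular G), vectorState_leftRegular, if_pos rfl]

theorem canonicalTrace_average {F : Type*} [Group F] [Fintype F] {j : F →* G}
    (hj : Function.Injective j) : canonicalTrace G (average j) = (Fintype.card F : ℂ)⁻¹ := by
  classical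
  have : canonicalTrace G (average j) =
      vectorState ((Fintype.card F : ℂ)⁻¹ • ∑ g, leftRegular G (j g)) := by
    change vectorState ((average j : CStarRed G) : L2 G →L[ℂ] L2 G) = _
    simp [average, unitaryOf]
  rw [this, map_smul, map_sum]
  simp [vectorState_leftRegular, map_eq_one_iff j hj]

theorem ProdGroup.incl_injective (F : Type*) [Group F] (n : ℕ) :
    Function.Injective (ProdGroup.incl F n) := by
  induction n with
  | zero => exact fun _ _ h => h
  | succ n ih => exact fun _ _ h => ih (congrArg Prod.snd h)

/-- The class of the averaging projection of a non-trivial finite subgroup is not an integer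
multiple of `[1]`, because its trace is `1 / |F|`. -/
theorem cls_average_ne {F : Type*} [Group F] [Fintype F] [Nontrivial F] {j : F →* G}
    (hj : Function.Injective j) (m : ℤ) :
    K0.cls₁ (average j) (isStarProjection_average j) ≠
      m • K0.cls₁ (1 : CStarRed G) (.one _) := by
  intro h
  have h1 := congrArg (K0.trace (canonicalTrace G) canonicalTrace_mul_comm) h
  rw [map_zsmul, K0.cls₁, K0.cls₁, K0.trace_cls, K0.trace_cls] at h1
  simp only [of_apply, Finset.univ_unique, Finset.sum_singleton, canonicalTrace_average hj,
    canonicalTrace_one, zsmul_eq_mul, mul_one] at h1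
  have hc : (Fintype.card F : ℂ) ≠ 0 := Nat.cast_ne_zero.2 Fintype.card_ne_zero
  have h2 : (Fintype.card F : ℤ) * m = 1 := by
    have : (Fintype.card F : ℂ) * m = 1 := by rw [← h1, mul_inv_cancel₀ hc]
    exact_mod_cast this
  have h3 : (1 : ℤ) < Fintype.card F := by exact_mod_cast Fintype.one_lt_card
  rcases Int.isUnit_iff.1 (IsUnit.of_mul_eq_one _ h2) with h4 | h4 <;> omega

end

end HigherKazhdan

end

theorem theorem4 {F : Type*} [Group F] [Fintype F] (C : HigherKazhdan.BasedComplex F)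
    (hC : C.IsResolution) (n : ℕ) :
    HigherKazhdan.HasSpectralGap ((HigherKazhdan.prodComplex C n).laplacianOp n) ∧
    ∃ (P : Matrix ((HigherKazhdan.prodComplex C n).Cells n)
        ((HigherKazhdan.prodComplex C n).Cells n)
        (HigherKazhdan.CStarRed (HigherKazhdan.ProdGroup F n)))
      (hP : IsStarProjection P),
      HigherKazhdan.matOp P = (HigherKazhdan.prodComplex C n).kazhdanProjection n ∧
      HigherKazhdan.K0.cls P hP =
        HigherKazhdan.K0.cls₁ (HigherKazhdan.average (HigherKazhdan.ProdGroup.incl F n))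
          (HigherKazhdan.isStarProjection_average _) ∧
      (Nontrivial F → ∀ m : ℤ, HigherKazhdan.K0.cls P hP ≠
        m • HigherKazhdan.K0.cls₁
          (1 : HigherKazhdan.CStarRed (HigherKazhdan.ProdGroup F n)) (.one _)) := by
  have hof : ∀ g : HigherKazhdan.ProdGroup F n, HigherKazhdan.ofGroupRing _
      (MonoidAlgebra.of ℤ _ g) = HigherKazhdan.unitaryOf _ g := fun g => by
    simp [HigherKazhdan.ofGroupRing, MonoidAlgebra.of_apply]
  obtain ⟨P, hP, -, hS, hcls⟩ := HigherKazhdan.exists_splits_prodComplex hC n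
    (HigherKazhdan.ofGroupRing (HigherKazhdan.ProdGroup F n))
    (fun g => by rw [hof, hof, HigherKazhdan.star_unitaryOf])
    HigherKazhdan.hasInvSqrt_freeCob
    (HigherKazhdan.isStarProjection_average (HigherKazhdan.ProdGroup.incl F n))
    (by simp only [hof]; rfl)
  refine ⟨hS.hasSpectralGap hP, P, hP, hS.matOp_eq_kazhdanProjection hP, hcls, fun _ m => ?_⟩
  rw [hcls]
  exact HigherKazhdan.cls_average_ne (HigherKazhdan.ProdGroup.incl_injective F n) m
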